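/- Let $\mathcal G$ be a finite groupoid with unit space $\mathcal G^0$, source $s$ and range $r$ (the product $xy$ is defined iff $s(x)=r(y)$). Let $\mathcal H,\mathcal K$ be a matched pair of subgroupoids: every $g\in\mathcal G$ is a product $hk$ with $h\in\mathcal H$, $k\in\mathcal K$, $s(h)=r(k)$, and $\mathcal H\cap\mathcal K\subset\mathcal G^0$. Then the decomposition $g=p_1(g)p_2(g)$, $p_1(g)\in\mathcal H$, $p_2(g)\in\mathcal K$, is unique. Put $m=s\circ p_1=r\circ p_2$, and let $\alpha(f)=f\circ m$, $\beta(f)=f\circ r$, $\hat\beta(f)=f\circ s$ be the representations of $C(\mathcal G^0)$ on $\ell^2(\mathcal G)$ by multiplication operators. Let $I=I_{\mathcal H,\mathcal K}$ be the operator on $\ell^2(\mathcal G\times\mathcal G)=\ell^2(\mathcal G)\otimes\ell^2(\mathcal G)$ given by $$I\xi(x,y)=\xi\big(x\,p_1(p_2(x)^{-1}y),\,p_2(x)^{-1}y\big)\ \text{ if } m(x)=r(y),\qquad I\xi(x,y)=0\ \text{ otherwise.}$$ Let $S=\{(\omega\otimes i)(I)\}$ and $\hat S=\{(i\otimes\omega)(I)\}$,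 where $\omega$ runs over the linear forms on $\mathcal L(\ell^2(\mathcal G))$. For $k\in\mathcal K$, $h\in\mathcal H$ with $s(k)=r(h)$ write $kh=(k\triangleright h)(k\triangleleft h)$ with $k\triangleright h\in\mathcal H$, $k\triangleleft h\in\mathcal K$. Then $\triangleright$ is a left action of $\mathcal K$ on the set $\mathcal H$ fibred by $r$, and $\triangleleft$ is a right action of $\mathcal H$ on the set $\mathcal K$ fibred by $s$. Let $\gamma^{\mathcal K}$ and $\delta^{\mathcal H}$ be the associated actions of $C(\mathcal K)$ on $C(\mathcal H)$ and of $C(\mathcal H)$ on $C(\mathcal K)$. The crossed products are the following von Neumann algebras. * $C(\mathcal K)\ltimes_{\gamma^{\mathcal K}}C(\mathcal H)$ acts on $\ell^2\{(h,k)\in\mathcal H\times\mathcal K: r(h)=s(k)\}$ and is generated by the multiplication operators $\gamma^{\mathcal K}(a):(h,k)\mapsto a(k\triangleright h)$, $a\in C(\mathcal H)$, and the left translations $\lambda(k_1)\xi(h,k)=\xi(h,k_1^{-1}k)$ if $r(k)=r(k_1)$, $0$ otherwise. * $C(\mathcal K)\rtimes_{\delta^{\mathcal H}}C(\mathcal H)$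 acts on $\ell^2\{(k,h)\in\mathcal K\times\mathcal H: s(k)=r(h)\}$ and is generated by the multiplication operators $\delta^{\mathcal H}(a):(k,h)\mapsto a(k\triangleleft h)$, $a\in C(\mathcal K)$, and the right translations $\rho(h_1)\xi(k,h)=\xi(k,hh_1)$ if $s(h)=r(h_1)$, $0$ otherwise. Then the following hold. 1. $I$ is a multiplicative partial isometry with base $(C(\mathcal G^0),\alpha,\beta,\hat\beta)$. That is, $\alpha,\beta,\hat\beta$ are injective unital representations, commute pairwise and satisfy $\mathrm{tr}\circ\alpha=\mathrm{tr}\circ\beta=\mathrm{tr}\circ\hat\beta$. With $e_{\sigma,\rho}=\sum_{u\in\mathcal G^0}\sigma(\chi_u)\otimes\rho(\chi_u)$ one has $I^*I=e_{\hat\beta,\alpha}$ and $II^*=e_{\alpha,\beta}$. Moreover $I$ commutes with all $\beta(n)\otimes\hat\beta(n')$, $I(\alpha(n)\otimes\beta(n'))=(\hat\beta(n')\otimes\alpha(n))I$, and $I_{12}I_{13}I_{23}=I_{23}I_{12}$. 2. $I$ is regular: $\{(i\otimes\omega)(\Sigma I)\}=\alpha(C(\mathcal G^0))'$, where $\Sigma$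 is the flip and $\omega$ runs over all linear forms. Moreover $S$ and $\hat S$ are unital $*$-subalgebras of $\mathcal L(\ell^2(\mathcal G))$. 3. There are $*$-isomorphisms $\Phi:C(\mathcal K)\ltimes_{\gamma^{\mathcal K}}C(\mathcal H)\to S$ and $\Psi:C(\mathcal K)\rtimes_{\delta^{\mathcal H}}C(\mathcal H)\to\hat S$, both given by the identification $(h,k)\mapsto kh$, respectively $(k,h)\mapsto kh$, of the index sets with $\mathcal G$. 4. Hence the two crossed products carry weak Hopf $C^*$-algebra structures $(\Gamma^\gamma,\kappa^\gamma,\epsilon^\gamma)$ and $(\Gamma^\delta,\kappa^\delta,\epsilon^\delta)$. Under $\Phi$ and $\Psi$ they are $$\Gamma(s)=I(s\otimes1)I^*,\quad \kappa((\omega\otimes i)(I))=(\omega\otimes i)(I^*),\quad \epsilon((\omega\otimes i)(I))=\omega(1)\quad\text{on } S,$$ $$\hat\Gamma(\hat s)=I^*(1\otimes\hat s)I,\quad \hat\kappa((i\otimes\omega)(I))=(i\otimes\omega)(I^*),\quad \hat\epsilon((i\otimes\omega)(I))=\omega(1)\quad\text{on }\hat S.$$ They are in duality by the bracket corresponding to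 $\langle(\omega\otimes i)(I),(i\otimes\omega')(I)\rangle=(\omega\otimes\omega')(I)$. Here a weak Hopf $C^*$-algebra is a finite-dimensional $C^*$-algebra $A$ with the following data. * A coassociative, multiplicative and $*$-preserving (not necessarily unital) coproduct $\Gamma:A\to A\otimes A$. * A linear antimultiplicative antipode $\kappa$ with $(\kappa\circ *)^2=i$, $(\kappa\otimes\kappa)\Gamma=\varsigma\Gamma\kappa$ ($\varsigma$ the flip) and $(\mathrm m(\kappa\otimes i)\otimes i)(\Gamma\otimes i)\Gamma(x)=(1\otimes x)\Gamma(1)$, $\mathrm m$ being the multiplication. * A positive linear form $\epsilon$ with $(\epsilon\otimes i)\Gamma=(i\otimes\epsilon)\Gamma=i$ and $(\epsilon\otimes\epsilon)((x\otimes1)\Gamma(1)(1\otimes y))=\epsilon(xy)$. Duality means that the bracket is bilinear and non-degenerate, with $\langle\Gamma(a),x\otimes y\rangle=\langle a,xy\rangle$, $\langle a\otimes b,\hat\Gamma(x)\rangle=\langle ab,x\rangle$, $\langle a,1\rangle=\epsilon(a)$, $\langle 1,x\rangle=\hat\epsilon(x)$, $\langle\kappa(a),x\rangle=\langle a,\hat\kappa(x)\rangle$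 and $\langle a^*,x\rangle=\overline{\langle a,\hat\kappa(x)^*\rangle}$. -/

import Mathlib

open CategoryTheory
open scoped TensorProduct Kronecker ComplexOrder

universe u v

namespace MatchedPair

/-! ### Finite groupoids, arrows and their partial product -/

/-- The set of all arrows of a groupoid. An arrow `g : s ⟶ r` has source `g.s` and range `g.r`. -/
@[ext]
structure Arr (C : Type u) [Groupoid.{v} C] where
  s : C
  r : C
  hom : s ⟶ r

namespace Arr

variable {C : Type u} [Groupoid.{v} C]

/-- The unit arrow at an object; this identifies the set of objects with a set of arrows. -/
def unit (a : C) : Arr C := ⟨a, a, 𝟙 a⟩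

instance : Inv (Arr C) := ⟨fun g => ⟨g.r, g.s, Groupoid.inv g.hom⟩⟩

open scoped Classical in
/-- The product `x * y` of two arrows: first `y`, then `x`. It is meaningful when `x.s = y.r`, and
has the irrelevant value `x` otherwise. -/
noncomputable instance : Mul (Arr C) :=
  ⟨fun x y => if h : y.r = x.s then ⟨y.s, x.r, y.hom ≫ eqToHom h ≫ x.hom⟩ else x⟩

noncomputable instance : DecidableEq (Arr C) := Classical.decEq _

instance [Finite C] [∀ a b : C, Finite (a ⟶ b)] : Finite (Arr C) :=
  Finite.of_injective (β := Σ a b : C, (a ⟶ b)) (fun g => ⟨g.s, g.r, g.hom⟩) (by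
    rintro ⟨a, b, f⟩ ⟨a', b', f'⟩ h
    simp only [Sigma.mk.injEq] at h
    obtain ⟨rfl, h⟩ := h
    simp only [heq_eq_eq, Sigma.mk.injEq] at h
    obtain ⟨rfl, h⟩ := h
    simp only [heq_eq_eq] at h
    rw [h])

noncomputable instance [Finite C] [∀ a b : C, Finite (a ⟶ b)] : Fintype (Arr C) :=
  Fintype.ofFinite _

theorem mk_mul_mk {a b c : C} (f : b ⟶ c) (g : a ⟶ b) :
    (⟨b, c, f⟩ * ⟨a, b, g⟩ : Arr C) = ⟨a, c, g ≫ f⟩ := by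
  refine (dif_pos rfl).trans ?_
  simp

theorem inv_mk {a b : C} (f : a ⟶ b) : (⟨a, b, f⟩ : Arr C)⁻¹ = ⟨b, a, Groupoid.inv f⟩ := rfl

theorem s_mul {x y : Arr C} (h : x.s = y.r) : (x * y).s = y.s := by
  obtain ⟨b, c, f⟩ := x
  obtain ⟨a, b', g⟩ := y
  obtain rfl : b = b' := h
  rw [mk_mul_mk]

theorem r_mul {x y : Arr C} (h : x.s = y.r) : (x * y).r = x.r := by
  obtain ⟨b, c, f⟩ := x
  obtain ⟨a, b', g⟩ := y
  obtain rfl : b = b' := h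
  rw [mk_mul_mk]

theorem assoc {x y z : Arr C} (h : x.s = y.r) (h' : y.s = z.r) : x * y * z = x * (y * z) := by
  obtain ⟨c, d, f⟩ := x
  obtain ⟨b, c', g⟩ := y
  obtain ⟨a, b', e⟩ := z
  obtain rfl : c = c' := h
  obtain rfl : b = b' := h'
  simp only [mk_mul_mk, Category.assoc]

theorem unit_mul (x : Arr C) : unit x.r * x = x := by
  obtain ⟨a, b, f⟩ := x
  simp only [unit, mk_mul_mk, Category.comp_id]

theorem mul_unit (x : Arr C) : x * unit x.s = x := by
  obtain ⟨a, b, f⟩ := x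
  simp only [unit, mk_mul_mk, Category.id_comp]

theorem inv_mul (x : Arr C) : x⁻¹ * x = unit x.s := by
  obtain ⟨a, b, f⟩ := x
  simp only [unit, inv_mk, mk_mul_mk, Groupoid.comp_inv]

theorem mul_inv (x : Arr C) : x * x⁻¹ = unit x.r := by
  obtain ⟨a, b, f⟩ := x
  simp only [unit, inv_mk, mk_mul_mk, Groupoid.inv_comp]

theorem s_inv (x : Arr C) : x⁻¹.s = x.r := rfl

theorem r_inv (x : Arr C) : x⁻¹.r = x.s := rfl

/-- The arrow `g` belongs to the subgroupoid `H`. -/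
def MemOf (g : Arr C) (H : Subgroupoid C) : Prop := g.hom ∈ H.arrows g.s g.r

theorem MemOf.mul {H : Subgroupoid C} {x y : Arr C} (hx : x.MemOf H) (hy : y.MemOf H)
    (h : x.s = y.r) : (x * y).MemOf H := by
  obtain ⟨b, c, f⟩ := x
  obtain ⟨a, b', g⟩ := y
  obtain rfl : b = b' := h
  rw [mk_mul_mk]
  exact H.mul hy hx

theorem MemOf.inv {H : Subgroupoid C} {x : Arr C} (hx : x.MemOf H) : x⁻¹.MemOf H :=
  H.inv hx

end Arr

/-- The arrows of a subgroupoid. -/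
abbrev SubArr {C : Type u} [Groupoid.{v} C] (H : Subgroupoid C) : Type (max u v) :=
  {g : Arr C // g.MemOf H}

/-! ### Actions of a groupoid on a fibred finite set, and their crossed products -/

section Actions

variable {C : Type u} [Groupoid.{v} C]

/-- A left action of the groupoid `K` on the set `X` fibred over the objects by `b`: the arrow `k`
maps the fibre over `s(k)` to the fibre over `r(k)`, functorially. The value of `act k x` is
irrelevant when `b x ≠ s(k)`. -/
structure LeftAction (K : Subgroupoid C) {X : Type*} (b : X → C) where
  act : SubArr K → X → X
  b_act : ∀ k x, b x = k.1.s → b (act k x) = k.1.r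
  unit_act : ∀ k x, k.1 = Arr.unit (b x) → act k x = x
  mul_act : ∀ k k' k'' x, k.1.s = k'.1.r → k''.1 = k.1 * k'.1 → b x = k'.1.s →
    act k'' x = act k (act k' x)

/-- A right action of the groupoid `H` on the set `X` fibred over the objects by `b`: the arrow `h`
maps the fibre over `r(h)` to the fibre over `s(h)`, contravariantly. The value of `act x h` is
irrelevant when `b x ≠ r(h)`. -/
structure RightAction (H : Subgroupoid C) {X : Type*} (b : X → C) where
  act : X → SubArr H → X
  b_act : ∀ x h, b x = h.1.r → b (act x h) = h.1.s
  act_unit : ∀ x h, h.1 = Arr.unit (b x) → act x h = x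
  act_mul : ∀ x h h' h'', h.1.s = h'.1.r → h''.1 = h.1 * h'.1 → b x = h.1.r →
    act x h'' = act (act x h) h'

variable [Finite C] [∀ a b : C, Finite (a ⟶ b)]

noncomputable instance (H : Subgroupoid C) : Fintype (SubArr H) := Fintype.ofFinite _

namespace LeftAction

variable {K : Subgroupoid C} {X : Type*} [Fintype X] [DecidableEq X] {b : X → C}

/-- The fibre product of `X` and `K` along `b` and the source map. -/
abbrev Fib (_ : LeftAction K b) := {p : X × SubArr K // b p.1 = p.2.1.s}

noncomputable instance (A : LeftAction K b) : Fintype A.Fib := Fintype.ofFinite _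

/-- The left action `γ` of `C(K)` on `C(X)`: the function `a` on `X` is sent to the function
`(x, g) ↦ a (g ▷ x)`, seen as a multiplication operator on `ℓ²` of the fibre product. -/
noncomputable def gamma (A : LeftAction K b) (a : X → ℂ) : Matrix A.Fib A.Fib ℂ :=
  Matrix.diagonal fun p => a (A.act p.1.2 p.1.1)

open scoped Classical in
/-- The operator `1 ⊗ λ(k)`: it sends `ξ` to `(x, g) ↦ ξ (x, k⁻¹ g)` where `r(g) = r(k)`, and `0`
elsewhere. -/
noncomputable def lam (A : LeftAction K b) (k : SubArr K) : Matrix A.Fib A.Fib ℂ :=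
  Matrix.of fun p q =>
    if p.1.2.1.r = k.1.r ∧ q.1.1 = p.1.1 ∧ q.1.2.1 = k.1⁻¹ * p.1.2.1 then 1 else 0

/-- The crossed product `C(K) ⋉ C(X)`: the von Neumann algebra (that is, unital `*`-algebra, in
finite dimension) of operators generated by `γ(C(X))` and the left translations. -/
noncomputable def crossedProduct (A : LeftAction K b) :
    StarSubalgebra ℂ (Matrix A.Fib A.Fib ℂ) :=
  StarAlgebra.adjoin ℂ (Set.range A.gamma ∪ Set.range A.lam)

end LeftAction

namespace RightAction

variable {H : Subgroupoid C} {X : Type*} [Fintype X] [DecidableEq X] {b : X → C}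

/-- The fibre product of `X` and `H` along `b` and the range map. -/
abbrev Fib (_ : RightAction H b) := {p : X × SubArr H // b p.1 = p.2.1.r}

noncomputable instance (A : RightAction H b) : Fintype A.Fib := Fintype.ofFinite _

/-- The right action `δ` of `C(H)` on `C(X)`: the function `a` on `X` is sent to the function
`(x, g) ↦ a (x ◁ g)`, seen as a multiplication operator on `ℓ²` of the fibre product. -/
noncomputable def delta (A : RightAction H b) (a : X → ℂ) : Matrix A.Fib A.Fib ℂ :=
  Matrix.diagonal fun p => a (A.act p.1.1 p.1.2)

open scoped Classical in
/-- The operator `1 ⊗ ρ(h)`: it sends `ξ` to `(x, g) ↦ ξ (x, g h)` where `s(g) = r(h)`, and `0`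
elsewhere. -/
noncomputable def rho (A : RightAction H b) (h : SubArr H) : Matrix A.Fib A.Fib ℂ :=
  Matrix.of fun p q =>
    if p.1.2.1.s = h.1.r ∧ q.1.1 = p.1.1 ∧ q.1.2.1 = p.1.2.1 * h.1 then 1 else 0

/-- The crossed product `C(X) ⋊ C(H)`: the von Neumann algebra (that is, unital `*`-algebra, in
finite dimension) of operators generated by `δ(C(X))` and the right translations. -/
noncomputable def crossedProduct (A : RightAction H b) :
    StarSubalgebra ℂ (Matrix A.Fib A.Fib ℂ) :=
  StarAlgebra.adjoin ℂ (Set.range A.delta ∪ Set.range A.rho)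

end RightAction

end Actions

/-! ### Multiplicative partial isometries

Operators on `ℓ²(ι)`, `ι` finite, are written as matrices in the canonical basis; `ℓ²(ι) ⊗ ℓ²(ι)` is
`ℓ²(ι × ι)` and the tensor product of operators is the Kronecker product `⊗ₖ`. -/

section MPI

variable {ι : Type*} [Fintype ι] [DecidableEq ι] {X : Type*} [Fintype X]

/-- `T₁₂` on `ℓ²(ι × ι × ι)`. -/
def leg12 (T : Matrix (ι × ι) (ι × ι) ℂ) : Matrix (ι × ι × ι) (ι × ι × ι) ℂ :=
  Matrix.of fun p q => if p.2.2 = q.2.2 then T (p.1, p.2.1) (q.1, q.2.1) else 0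

/-- `T₁₃` on `ℓ²(ι × ι × ι)`. -/
def leg13 (T : Matrix (ι × ι) (ι × ι) ℂ) : Matrix (ι × ι × ι) (ι × ι × ι) ℂ :=
  Matrix.of fun p q => if p.2.1 = q.2.1 then T (p.1, p.2.2) (q.1, q.2.2) else 0

/-- `T₂₃` on `ℓ²(ι × ι × ι)`. -/
def leg23 (T : Matrix (ι × ι) (ι × ι) ℂ) : Matrix (ι × ι × ι) (ι × ι × ι) ℂ :=
  Matrix.of fun p q => if p.1 = q.1 then T p.2 q.2 else 0

/-- The flip `Σ` of `ℓ²(ι × ι)`. -/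
def flipOp : Matrix (ι × ι) (ι × ι) ℂ :=
  Matrix.of fun p q => if p.1 = q.2 ∧ p.2 = q.1 then 1 else 0

/-- The slice `(ω ⊗ i)(T)` of an operator by a linear form `ω`. -/
def sliceL (ω : Matrix ι ι ℂ →ₗ[ℂ] ℂ) (T : Matrix (ι × ι) (ι × ι) ℂ) : Matrix ι ι ℂ :=
  Matrix.of fun y y' => ω (Matrix.of fun x x' => T (x, y) (x', y'))

/-- The slice `(i ⊗ ω)(T)` of an operator by a linear form `ω`. -/
def sliceR (ω : Matrix ι ι ℂ →ₗ[ℂ] ℂ) (T : Matrix (ι × ι) (ι × ι) ℂ) : Matrix ι ι ℂ :=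
  Matrix.of fun x x' => ω (Matrix.of fun y y' => T (x, y) (x', y'))

/-- The set `S` of all `(ω ⊗ i)(I)`. -/
def legS (I : Matrix (ι × ι) (ι × ι) ℂ) : Set (Matrix ι ι ℂ) :=
  Set.range fun ω : Matrix ι ι ℂ →ₗ[ℂ] ℂ => sliceL ω I

/-- The set `Ŝ` of all `(i ⊗ ω)(I)`. -/
def legShat (I : Matrix (ι × ι) (ι × ι) ℂ) : Set (Matrix ι ι ℂ) :=
  Set.range fun ω : Matrix ι ι ℂ →ₗ[ℂ] ℂ => sliceR ω I

/-- The projection `e_{σ,ρ}` of two representations of the commutative algebra `C(X)`, namely the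
sum of the `σ(χ_u) ⊗ ρ(χ_u)` over the minimal projections `χ_u` of `C(X)`. -/
noncomputable def eProj (σ ρ : (X → ℂ) →⋆ₐ[ℂ] Matrix ι ι ℂ) : Matrix (ι × ι) (ι × ι) ℂ :=
  ∑ u : X, σ (Set.indicator {u} fun _ => 1) ⊗ₖ ρ (Set.indicator {u} fun _ => 1)

/-- `I` is a multiplicative partial isometry on `ℓ²(ι)` with base `(C(X), α, β, β̂)`. The base is
commutative, so anti-representations of it are representations. The projections `e_{β̂,α}` and
`e_{α,β}` are the initial and the final support of `I`. -/
structure IsMPI (I : Matrix (ι × ι) (ι × ι) ℂ) (α β β' : (X → ℂ) →⋆ₐ[ℂ] Matrix ι ι ℂ) :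
    Prop where
  injective_alpha : Function.Injective α
  injective_beta : Function.Injective β
  injective_beta' : Function.Injective β'
  commute_alpha_beta : ∀ n n', Commute (α n) (β n')
  commute_alpha_beta' : ∀ n n', Commute (α n) (β' n')
  commute_beta_beta' : ∀ n n', Commute (β n) (β' n')
  trace_beta : ∀ n, (α n).trace = (β n).trace
  trace_beta' : ∀ n, (α n).trace = (β' n).trace
  initial : I.conjTranspose * I = eProj β' α
  final : I * I.conjTranspose = eProj α β
  commute : ∀ n n', Commute I (β n ⊗ₖ β' n')
  intertwine : ∀ n n', I * (α n ⊗ₖ β n') = (β' n' ⊗ₖ α n) * I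
  pentagon : leg12 I * leg13 I * leg23 I = leg23 I * leg12 I

/-- Regularity of `I`: the operators `(i ⊗ ω)(Σ I)` are exactly the commutant of `α(C(X))`. -/
def IsRegularMPI (I : Matrix (ι × ι) (ι × ι) ℂ) (α : (X → ℂ) →⋆ₐ[ℂ] Matrix ι ι ℂ) : Prop :=
  (Set.range fun ω : Matrix ι ι ℂ →ₗ[ℂ] ℂ => sliceR ω (flipOp * I)) =
    Set.centralizer (Set.range α)

end MPI

/-! ### Weak Hopf C*-algebras -/

section WeakHopf

variable (A : Type*) [Ring A] [StarRing A] [Algebra ℂ A] [StarModule ℂ A]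

/-- A weak Hopf C*-algebra structure on a `*`-algebra `A`. The field `exists_faithful_rep` says that
`A` is a finite-dimensional C*-algebra: it is a `*`-subalgebra of some `Mₙ(ℂ)`. -/
structure WeakHopfCStar extends Coalgebra ℂ A where
  exists_faithful_rep : ∃ (n : ℕ) (π : A →⋆ₐ[ℂ] Matrix (Fin n) (Fin n) ℂ), Function.Injective π
  comul_mul : ∀ x y, comul (x * y) = comul x * comul y
  comul_star : ∀ x, comul (star x) = star (comul x)
  /-- the antipode `κ` -/
  antipode : A →ₗ[ℂ] A
  antipode_star : ∀ x, antipode (star (antipode (star x))) = x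
  antipode_mul : ∀ x y, antipode (x * y) = antipode y * antipode x
  antipode_comul : ∀ x,
    TensorProduct.map antipode antipode (comul x) = TensorProduct.comm ℂ A A (comul (antipode x))
  /-- `(m(κ ⊗ i) ⊗ i)(Γ ⊗ i)Γ(x) = (1 ⊗ x)Γ(1)` -/
  antipode_axiom : ∀ x,
    (LinearMap.mul' ℂ A ∘ₗ antipode.rTensor A).rTensor A (comul.rTensor A (comul x)) =
      ((1 : A) ⊗ₜ[ℂ] x) * comul 1
  counit_nonneg : ∀ x, 0 ≤ counit (star x * x)
  /-- `(ε ⊗ ε)((x ⊗ 1)Γ(1)(1 ⊗ y)) = ε(xy)` -/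
  counit_mul : ∀ x y,
    LinearMap.mul' ℂ ℂ (TensorProduct.map counit counit
      ((x ⊗ₜ[ℂ] (1 : A)) * comul 1 * ((1 : A) ⊗ₜ[ℂ] y))) = counit (x * y)

variable {A} {B : Type*} [Ring B] [StarRing B] [Algebra ℂ B] [StarModule ℂ B]

/-- The bilinear bracket `⟨·,·⟩` is a duality between two weak Hopf C*-algebras: it is
non-degenerate, each product is dual to the other coproduct, each unit to the other counit, the
antipodes are dual to each other, and `⟨a*, x⟩` is the conjugate of `⟨a, κ(x)*⟩`. -/
structure IsDuality (V : WeakHopfCStar A) (W : WeakHopfCStar B) (br : A →ₗ[ℂ] B →ₗ[ℂ] ℂ) :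
    Prop where
  nondegenerate : br.Nondegenerate
  comul_left : ∀ a x y,
    LinearMap.mul' ℂ ℂ (TensorProduct.map (br.flip x) (br.flip y) (V.comul a)) = br a (x * y)
  comul_right : ∀ a b x,
    LinearMap.mul' ℂ ℂ (TensorProduct.map (br a) (br b) (W.comul x)) = br (a * b) x
  counit_left : ∀ a, br a 1 = V.counit a
  counit_right : ∀ x, br 1 x = W.counit x
  antipode : ∀ a x, br (V.antipode a) x = br a (W.antipode x)
  star_left : ∀ a x, br (star a) x = star (br a (star (W.antipode x)))

/-- The map `Φ ⊗ Φ`, for `Φ` with values in the operators on `ℓ²(ι)`, with values in the operators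
on `ℓ²(ι × ι)`. -/
noncomputable def tensorSq {ι : Type*} (Φ : A →ₗ[ℂ] Matrix ι ι ℂ) :
    A ⊗[ℂ] A →ₗ[ℂ] Matrix (ι × ι) (ι × ι) ℂ :=
  TensorProduct.lift ((Matrix.kroneckerBilinear (R := ℂ) (α := ℂ)).compl₁₂ Φ Φ)

variable {ι : Type*} [Fintype ι] [DecidableEq ι]

/-- The weak Hopf C*-algebra structure `V` on `A` is the one which `I` defines on `S`, transported
by the representation `Φ` of `A` on `ℓ²(ι)` (to be used with `Φ` injective with image `S`):
`Γ(s) = I (s ⊗ 1) I*`, `κ((ω ⊗ i)(I)) = (ω ⊗ i)(I*)` and `ε((ω ⊗ i)(I)) = ω(1)`. -/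
structure IsInducedOnS (I : Matrix (ι × ι) (ι × ι) ℂ) (Φ : A →⋆ₐ[ℂ] Matrix ι ι ℂ)
    (V : WeakHopfCStar A) : Prop where
  comul : ∀ a, tensorSq Φ.toAlgHom.toLinearMap (V.comul a) =
    I * (Φ a ⊗ₖ (1 : Matrix ι ι ℂ)) * I.conjTranspose
  antipode : ∀ ω a, Φ a = sliceL ω I → Φ (V.antipode a) = sliceL ω I.conjTranspose
  counit : ∀ ω a, Φ a = sliceL ω I → V.counit a = ω 1

/-- The weak Hopf C*-algebra structure `W` on `B` is the one which `I` defines on `Ŝ`, transported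
by the representation `Ψ` of `B` on `ℓ²(ι)` (to be used with `Ψ` injective with image `Ŝ`):
`Γ(s) = I* (1 ⊗ s) I`, `κ((i ⊗ ω)(I)) = (i ⊗ ω)(I*)` and `ε((i ⊗ ω)(I)) = ω(1)`. -/
structure IsInducedOnShat (I : Matrix (ι × ι) (ι × ι) ℂ) (Ψ : B →⋆ₐ[ℂ] Matrix ι ι ℂ)
    (W : WeakHopfCStar B) : Prop where
  comul : ∀ x, tensorSq Ψ.toAlgHom.toLinearMap (W.comul x) =
    I.conjTranspose * ((1 : Matrix ι ι ℂ) ⊗ₖ Ψ x) * I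
  antipode : ∀ ω x, Ψ x = sliceR ω I → Ψ (W.antipode x) = sliceR ω I.conjTranspose
  counit : ∀ ω x, Ψ x = sliceR ω I → W.counit x = ω 1

/-- The bracket `⟨(ω ⊗ i)(I), (i ⊗ ω')(I)⟩ = (ω ⊗ ω')(I)`, transported by `Φ` and `Ψ`. -/
def IsInducedBracket (I : Matrix (ι × ι) (ι × ι) ℂ) (Φ : A →⋆ₐ[ℂ] Matrix ι ι ℂ)
    (Ψ : B →⋆ₐ[ℂ] Matrix ι ι ℂ) (br : A →ₗ[ℂ] B →ₗ[ℂ] ℂ) : Prop :=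
  ∀ ω ω' a x, Φ a = sliceL ω I → Ψ x = sliceR ω' I → br a x = ω' (sliceL ω I)

end WeakHopf

/-! ### Matched pairs of groupoids -/

/-- A matched pair of groupoids: two subgroupoids `H`, `K` of a groupoid such that every arrow is a
product `h k` with `h ∈ H`, `k ∈ K`, and such that `H ∩ K` consists of units. -/
structure MatchPair (C : Type u) [Groupoid.{v} C] where
  H : Subgroupoid C
  K : Subgroupoid C
  exists_eq_mul : ∀ g : Arr C, ∃ h k : Arr C, h.MemOf H ∧ k.MemOf K ∧ h.s = k.r ∧ g = h * k
  inter : ∀ g : Arr C, g.MemOf H → g.MemOf K → ∃ a : C, g = Arr.unit a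

namespace MatchPair

variable {C : Type u} [Groupoid.{v} C] (P : MatchPair C)

/-- The `H`-component `p₁` of an arrow. -/
noncomputable def p₁ (g : Arr C) : Arr C := (P.exists_eq_mul g).choose

/-- The `K`-component `p₂` of an arrow. -/
noncomputable def p₂ (g : Arr C) : Arr C := (P.exists_eq_mul g).choose_spec.choose

/-- The middle map `m = s ∘ p₁ = r ∘ p₂`. -/
noncomputable def m (g : Arr C) : C := (P.p₁ g).s

theorem p₁_mem (g : Arr C) : (P.p₁ g).MemOf P.H :=
  (P.exists_eq_mul g).choose_spec.choose_spec.1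

theorem p₂_mem (g : Arr C) : (P.p₂ g).MemOf P.K :=
  (P.exists_eq_mul g).choose_spec.choose_spec.2.1

theorem s_p₁ (g : Arr C) : (P.p₁ g).s = (P.p₂ g).r :=
  (P.exists_eq_mul g).choose_spec.choose_spec.2.2.1

theorem eq_p₁_mul_p₂ (g : Arr C) : g = P.p₁ g * P.p₂ g :=
  (P.exists_eq_mul g).choose_spec.choose_spec.2.2.2

theorem r_p₁ (g : Arr C) : (P.p₁ g).r = g.r := by
  conv_rhs => rw [P.eq_p₁_mul_p₂ g, Arr.r_mul (P.s_p₁ g)]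

theorem s_p₂ (g : Arr C) : (P.p₂ g).s = g.s := by
  conv_rhs => rw [P.eq_p₁_mul_p₂ g, Arr.s_mul (P.s_p₁ g)]

/-- The decomposition is unique. -/
theorem p_unique {h k : Arr C} (hh : h.MemOf P.H) (hk : k.MemOf P.K) (hs : h.s = k.r) :
    P.p₁ (h * k) = h ∧ P.p₂ (h * k) = k := by
  set h' := P.p₁ (h * k) with hh'
  set k' := P.p₂ (h * k) with hk'
  have e : h * k = h' * k' := P.eq_p₁_mul_p₂ _
  have hs' : h'.s = k'.r := P.s_p₁ _
  have mh' : h'.MemOf P.H := P.p₁_mem _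
  have mk' : k'.MemOf P.K := P.p₂_mem _
  have er : h'.r = h.r := by rw [hh', P.r_p₁, Arr.r_mul hs]
  have es : k'.s = k.s := by rw [hk', P.s_p₂, Arr.s_mul hs]
  clear_value h' k'
  have key : h'⁻¹ * h = k' * k⁻¹ := by
    have e1 : h'⁻¹ * (h * k) * k⁻¹ = h'⁻¹ * h := by
      rw [← Arr.assoc (by rw [Arr.s_inv, er]) hs,
        Arr.assoc (by rw [Arr.s_mul (by rw [Arr.s_inv, er]), hs]) (by rw [Arr.r_inv]),
        Arr.mul_inv, ← hs, ← Arr.s_mul (x := h'⁻¹) (y := h) (by rw [Arr.s_inv, er]), Arr.mul_unit]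
    have e2 : h'⁻¹ * (h' * k') * k⁻¹ = k' * k⁻¹ := by
      rw [← Arr.assoc (by rw [Arr.s_inv]) hs', Arr.inv_mul, hs', Arr.unit_mul]
    rw [← e1, e, e2]
  have mH : (h'⁻¹ * h).MemOf P.H := mh'.inv.mul hh (by rw [Arr.s_inv, er])
  have mK : (h'⁻¹ * h).MemOf P.K := by
    rw [key]; exact mk'.mul hk.inv (by rw [Arr.r_inv, es])
  obtain ⟨a, ha⟩ := P.inter _ mH mK
  have a1 : a = h'.s := by
    have := congrArg Arr.r ha
    rw [Arr.r_mul (by rw [Arr.s_inv, er]), Arr.r_inv] at this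
    exact this.symm
  have a2 : a = h.s := by
    have := congrArg Arr.s ha
    rw [Arr.s_mul (by rw [Arr.s_inv, er])] at this
    exact this.symm
  have f1 : h = h' := by
    have : h' * (h'⁻¹ * h) = h := by
      rw [← Arr.assoc (by rw [Arr.r_inv]) (by rw [Arr.s_inv, er]), Arr.mul_inv, er, Arr.unit_mul]
    rw [← this, ha, a1, Arr.mul_unit]
  have f2 : k' = k := by
    have hk2 : k' * k⁻¹ = Arr.unit k.r := by rw [← key, ha, a2, hs]
    have : k' * k⁻¹ * k = k' := by
      rw [Arr.assoc (by rw [Arr.r_inv, es]) (by rw [Arr.s_inv]), Arr.inv_mul, ← es, Arr.mul_unit]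
    rw [← this, hk2, Arr.unit_mul]
  exact ⟨f1.symm, f2⟩

theorem p₁_mul {h k : Arr C} (hh : h.MemOf P.H) (hk : k.MemOf P.K) (hs : h.s = k.r) :
    P.p₁ (h * k) = h := (P.p_unique hh hk hs).1

theorem p₂_mul {h k : Arr C} (hh : h.MemOf P.H) (hk : k.MemOf P.K) (hs : h.s = k.r) :
    P.p₂ (h * k) = k := (P.p_unique hh hk hs).2

theorem unit_mem (a : C) : (Arr.unit a).MemOf P.H ∧ (Arr.unit a).MemOf P.K := by
  have e := P.eq_p₁_mul_p₂ (Arr.unit a)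
  have hs := P.s_p₁ (Arr.unit a)
  have h1 : (P.p₁ (Arr.unit a)).MemOf P.H := P.p₁_mem _
  have h2 : (P.p₂ (Arr.unit a)).MemOf P.K := P.p₂_mem _
  have hr : (P.p₁ (Arr.unit a)).r = a := P.r_p₁ _
  have hk : (P.p₂ (Arr.unit a)).s = a := P.s_p₂ _
  generalize P.p₁ (Arr.unit a) = h at *
  generalize P.p₂ (Arr.unit a) = k at *
  have e1 : h⁻¹ = k := by
    have : h⁻¹ * (h * k) = k := by
      rw [← Arr.assoc (by rw [Arr.s_inv]) hs, Arr.inv_mul, hs, Arr.unit_mul]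
    rw [← this, ← e, ← hr, ← Arr.s_inv h, Arr.mul_unit]
  obtain ⟨b, hb⟩ := P.inter k (e1 ▸ h1.inv) h2
  have hba : b = a := by rw [hb] at hk; exact hk
  subst hba
  exact ⟨hb ▸ e1 ▸ h1.inv, hb ▸ h2⟩

theorem unit_mem_H (a : C) : (Arr.unit a).MemOf P.H := (P.unit_mem a).1

theorem unit_mem_K (a : C) : (Arr.unit a).MemOf P.K := (P.unit_mem a).2

/-- The left action `▷` of `K` on `H` fibred by the range map: `k h = (k ▷ h)(k ◁ h)` for
`s(k) = r(h)`. -/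
noncomputable def leftAction : LeftAction P.K (fun h : SubArr P.H => h.1.r) where
  act k h := ⟨P.p₁ (k.1 * h.1), P.p₁_mem _⟩
  b_act k h e := by
    change (P.p₁ (k.1 * h.1)).r = k.1.r
    rw [P.r_p₁, Arr.r_mul e.symm]
  unit_act k h e := by
    apply Subtype.ext
    change P.p₁ (k.1 * h.1) = h.1
    have hu : (Arr.unit h.1.s).MemOf P.K := P.unit_mem_K _
    rw [e, Arr.unit_mul]
    conv_lhs => rw [← Arr.mul_unit h.1]
    exact P.p₁_mul h.2 hu rfl
  mul_act k k' k'' h e e'' e' := by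
    apply Subtype.ext
    change P.p₁ (k''.1 * h.1) = P.p₁ (k.1 * P.p₁ (k'.1 * h.1))
    have h1 : k.1.s = (P.p₁ (k'.1 * h.1)).r := by rw [P.r_p₁, Arr.r_mul e'.symm, e]
    rw [e'', Arr.assoc e e'.symm]
    conv_lhs => rw [P.eq_p₁_mul_p₂ (k'.1 * h.1), ← Arr.assoc h1 (P.s_p₁ _),
      P.eq_p₁_mul_p₂ (k.1 * P.p₁ (k'.1 * h.1))]
    have h2 : (P.p₂ (k.1 * P.p₁ (k'.1 * h.1))).s = (P.p₂ (k'.1 * h.1)).r := by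
      rw [P.s_p₂, Arr.s_mul h1, P.s_p₁]
    rw [Arr.assoc (P.s_p₁ _) h2]
    exact P.p₁_mul (P.p₁_mem _) ((P.p₂_mem _).mul (P.p₂_mem _) h2)
      ((P.s_p₁ _).trans (Arr.r_mul h2).symm)

/-- The right action `◁` of `H` on `K` fibred by the source map: `k h = (k ▷ h)(k ◁ h)` for
`s(k) = r(h)`. -/
noncomputable def rightAction : RightAction P.H (fun k : SubArr P.K => k.1.s) where
  act k h := ⟨P.p₂ (k.1 * h.1), P.p₂_mem _⟩
  b_act k h e := by
    change (P.p₂ (k.1 * h.1)).s = h.1.s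
    rw [P.s_p₂, Arr.s_mul e]
  act_unit k h e := by
    apply Subtype.ext
    change P.p₂ (k.1 * h.1) = k.1
    have hu : (Arr.unit k.1.r).MemOf P.H := P.unit_mem_H _
    rw [e, Arr.mul_unit]
    conv_lhs => rw [← Arr.unit_mul k.1]
    exact P.p₂_mul hu k.2 rfl
  act_mul k h h' h'' e e'' e' := by
    apply Subtype.ext
    change P.p₂ (k.1 * h''.1) = P.p₂ (P.p₂ (k.1 * h.1) * h'.1)
    have h1 : (P.p₂ (k.1 * h.1)).s = h'.1.r := by rw [P.s_p₂, Arr.s_mul e', e]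
    rw [e'', ← Arr.assoc e' e]
    conv_lhs => rw [P.eq_p₁_mul_p₂ (k.1 * h.1), Arr.assoc (P.s_p₁ _) h1,
      P.eq_p₁_mul_p₂ (P.p₂ (k.1 * h.1) * h'.1)]
    have h2 : (P.p₁ (k.1 * h.1)).s = (P.p₁ (P.p₂ (k.1 * h.1) * h'.1)).r := by
      rw [P.r_p₁, Arr.r_mul h1, P.s_p₁]
    rw [← Arr.assoc h2 (P.s_p₁ _)]
    exact P.p₂_mul ((P.p₁_mem _).mul (P.p₁_mem _) h2) (P.p₂_mem _)
      ((Arr.s_mul h2).trans (P.s_p₁ _))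

variable [Finite C] [∀ a b : C, Finite (a ⟶ b)]

/-- The representation of `C(C) = (C → ℂ)` on `ℓ²` of the set of arrows given by a map `q` from
arrows to objects: `f` acts as multiplication by `f ∘ q`. -/
noncomputable def baseRep (q : Arr C → C) : (C → ℂ) →⋆ₐ[ℂ] Matrix (Arr C) (Arr C) ℂ where
  toFun f := Matrix.diagonal fun g => f (q g)
  map_one' := by simp
  map_mul' f f' := by simp
  map_zero' := by simp
  map_add' f f' := by simp
  commutes' c := by simp [Matrix.algebraMap_eq_diagonal]
  map_star' f := by
    simp [Matrix.star_eq_conjTranspose, Matrix.diagonal_conjTranspose]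

/-- The middle representation. -/
noncomputable def α : (C → ℂ) →⋆ₐ[ℂ] Matrix (Arr C) (Arr C) ℂ := baseRep P.m

/-- The range representation. -/
noncomputable def β (_ : MatchPair C) : (C → ℂ) →⋆ₐ[ℂ] Matrix (Arr C) (Arr C) ℂ := baseRep Arr.r

/-- The source representation. -/
noncomputable def βhat (_ : MatchPair C) : (C → ℂ) →⋆ₐ[ℂ] Matrix (Arr C) (Arr C) ℂ :=
  baseRep Arr.s

open scoped Classical in
/-- The operator `I_{H,K}` on `ℓ²(G × G)`; see `I_mulVec`. -/
noncomputable def I : Matrix (Arr C × Arr C) (Arr C × Arr C) ℂ :=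
  Matrix.of fun p q =>
    if P.m p.1 = p.2.r ∧ q = (p.1 * P.p₁ ((P.p₂ p.1)⁻¹ * p.2), (P.p₂ p.1)⁻¹ * p.2) then 1 else 0

open scoped Classical in
theorem I_mulVec (f : Arr C × Arr C → ℂ) (x y : Arr C) :
    P.I.mulVec f (x, y) =
      if P.m x = y.r then f (x * P.p₁ ((P.p₂ x)⁻¹ * y), (P.p₂ x)⁻¹ * y) else 0 := by
  by_cases h : P.m x = y.r <;> simp [I, Matrix.mulVec, dotProduct, h]

/-- The crossed product `C(K) ⋉ C(H)` by the left action associated with `▷`. -/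
noncomputable abbrev leftCrossed :
    StarSubalgebra ℂ (Matrix P.leftAction.Fib P.leftAction.Fib ℂ) :=
  P.leftAction.crossedProduct

/-- The crossed product `C(K) ⋊ C(H)` by the right action associated with `◁`. -/
noncomputable abbrev rightCrossed :
    StarSubalgebra ℂ (Matrix P.rightAction.Fib P.rightAction.Fib ℂ) :=
  P.rightAction.crossedProduct

end MatchPair

end MatchedPair

open MatchedPair

/-!
An arrow `g` of a groupoid with a matched pair of subgroupoids `H`, `K` has two decompositions,
`g = p₁ g * p₂ g` with `p₁ g ∈ H`, `p₂ g ∈ K`, and `g = q₁ g * q₂ g` with `q₁ g ∈ K`, `q₂ g ∈ H`. So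
`g` is the diagonal of a commutative square with upper side `p₁ g`, right side `p₂ g`, left side
`q₁ g` and lower side `q₂ g`. Squares compose vertically and horizontally, and they form a double
groupoid (`MatchPair.squares`) which is vacant: a square is determined by any two adjacent sides,
and these may be prescribed. Everything in the theorem is an assertion about this double groupoid.

Let `L g` be the left regular representation of the vertical groupoid on `ℓ²` of the set of squares,
and `R g` the right regular representation of the horizontal one. The operator `I` is
`∑ g, R g ⊗ L g` (`MatchPair.I_eq_mpi`, `VacantDoubleGroupoid.mpi_eq_sum`). Since the `L g` are
linearly independent, and so are the `R g`, the algebra `S` is the span of the `L g`, that is, the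
convolution algebra of the vertical groupoid, and `Ŝ` is that of the horizontal groupoid. The
generators of the crossed products are sums of operators `L g`, respectively `R g`, and each `L g`,
`R g` is a product of two generators; this gives `Φ` and `Ψ`.

The weak Hopf structure on the convolution algebra of the vertical groupoid is the following: the
coproduct of a square is the sum of its horizontal factorizations, the counit is the characteristic
function of the horizontal units, and the antipode inverts squares in both directions. The axioms
involving the product, the formula `Γ(s) = I (s ⊗ 1) I*` and the pentagon equation all rest on one
geometric fact, `VacantDoubleGroupoid.exists_factor`: a horizontal and a vertical factorization of a
square have a common refinement into four squares. The structure on `Ŝ` is that of the transposed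
double groupoid, and the bracket is the one for which the bases `L g` and `R g` are dual to each
other, because `I = ∑ g, R g ⊗ L g`.

The supports of `I` and its regularity express that squares with two prescribed adjacent sides exist
and are unique.
-/

namespace MatchedPair

/-! ### Vacant double groupoids -/

/-- A groupoid presented by its set of arrows `G` alone: units are arrows, `r x` and `s x` are the
units at the range and at the source of `x`, and the product `mul x y` is meaningful when
`s x = r y`. -/
structure ArrowGroupoid (G : Type*) where
  r : G → G
  s : G → G
  mul : G → G → G
  inv : G → G
  s_r : ∀ x, s (r x) = r x
  r_s : ∀ x, r (s x) = s x
  r_mul : ∀ x y, s x = r y → r (mul x y) = r x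
  s_mul : ∀ x y, s x = r y → s (mul x y) = s y
  assoc : ∀ x y z, s x = r y → s y = r z → mul (mul x y) z = mul x (mul y z)
  r_mul_self : ∀ x, mul (r x) x = x
  mul_s_self : ∀ x, mul x (s x) = x
  r_inv : ∀ x, r (inv x) = s x
  s_inv : ∀ x, s (inv x) = r x
  inv_mul : ∀ x, mul (inv x) x = s x
  mul_inv : ∀ x, mul x (inv x) = r x

namespace ArrowGroupoid

attribute [grind =] s_r r_s r_mul s_mul assoc r_mul_self mul_s_self r_inv s_inv inv_mul mul_inv

variable {G : Type*} (V : ArrowGroupoid G)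

@[grind =]
theorem r_r (x : G) : V.r (V.r x) = V.r x := by
  grind [V.r_mul (V.r x) x (V.s_r x)]

@[grind =]
theorem mul_inv_cancel_left {x y : G} (h : V.r x = V.r y) :
    V.mul x (V.mul (V.inv x) y) = y := by
  rw [← V.assoc _ _ _ (V.r_inv x).symm (by rw [V.s_inv, h]), V.mul_inv, h, V.r_mul_self]

@[grind =]
theorem inv_mul_cancel_left {x y : G} (h : V.s x = V.r y) :
    V.mul (V.inv x) (V.mul x y) = y := by
  rw [← V.assoc _ _ _ (V.s_inv x) h, V.inv_mul, h, V.r_mul_self]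

@[grind =]
theorem mul_inv_cancel_right {x y : G} (h : V.s x = V.r y) :
    V.mul (V.mul x y) (V.inv y) = x := by
  grind

@[grind =]
theorem inv_mul_cancel_right {x y : G} (h : V.s x = V.s y) :
    V.mul (V.mul x (V.inv y)) y = x := by
  grind

theorem eq_inv {x y : G} (h : V.s x = V.r y) (e : V.mul x y = V.r x) : y = V.inv x := by
  rw [← V.inv_mul_cancel_left h, e, ← V.s_inv x, V.mul_s_self]

@[grind =]
theorem inv_inv (x : G) : V.inv (V.inv x) = x :=
  (V.eq_inv (V.s_inv x) (by rw [V.inv_mul, V.r_inv])).symm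

theorem mul_left_cancel {x y z : G} (h : V.s x = V.r y) (h' : V.s x = V.r z)
    (e : V.mul x y = V.mul x z) : y = z := by
  rw [← V.inv_mul_cancel_left h, e, V.inv_mul_cancel_left h']

theorem mul_right_cancel {x y z : G} (h : V.s y = V.r x) (h' : V.s z = V.r x)
    (e : V.mul y x = V.mul z x) : y = z := by
  rw [← V.mul_inv_cancel_right h, e, V.mul_inv_cancel_right h']

@[grind =]
theorem inv_mul_rev {x y : G} (h : V.s x = V.r y) :
    V.inv (V.mul x y) = V.mul (V.inv y) (V.inv x) := by
  symm
  apply V.eq_inv <;> grind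

theorem inv_injective : Function.Injective V.inv :=
  Function.LeftInverse.injective V.inv_inv

end ArrowGroupoid

/-- A vacant double groupoid: the elements of `G` are squares, the vertical groupoid `V` composes
squares one above the other and the horizontal groupoid `H` composes them side by side. The units of
each groupoid are the degenerate squares, so that `V.r x`, `V.s x` stand for the upper and the lower
side of the square `x`, and `H.r x`, `H.s x` for its left and its right side. Vacancy means that a
square is determined by its left and lower sides, as well as by its right and upper sides, and that
these can be prescribed as soon as they meet in a corner. The remaining two pairs of adjacent sides
follow by inversion. The sides are functorial: `r_mul` and `s_mul` concern the vertical product,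
`r_mul'` and `s_mul'` the horizontal one. -/
structure VacantDoubleGroupoid (G : Type*) where
  V : ArrowGroupoid G
  H : ArrowGroupoid G
  r_r : ∀ x, V.r (H.r x) = H.r (V.r x)
  r_s : ∀ x, V.r (H.s x) = H.s (V.r x)
  s_r : ∀ x, V.s (H.r x) = H.r (V.s x)
  s_s : ∀ x, V.s (H.s x) = H.s (V.s x)
  r_mul : ∀ x y, V.s x = V.r y → H.r (V.mul x y) = V.mul (H.r x) (H.r y)
  s_mul : ∀ x y, V.s x = V.r y → H.s (V.mul x y) = V.mul (H.s x) (H.s y)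
  r_mul' : ∀ x y, H.s x = H.r y → V.r (H.mul x y) = H.mul (V.r x) (V.r y)
  s_mul' : ∀ x y, H.s x = H.r y → V.s (H.mul x y) = H.mul (V.s x) (V.s y)
  ext_rs : ∀ x y, H.r x = H.r y → V.s x = V.s y → x = y
  ext_sr : ∀ x y, H.s x = H.s y → V.r x = V.r y → x = y
  fill_rs : ∀ x y, V.s (H.r x) = H.r (V.s y) → ∃ z, H.r z = H.r x ∧ V.s z = V.s y
  fill_sr : ∀ x y, V.r (H.s x) = H.s (V.r y) → ∃ z, H.s z = H.s x ∧ V.r z = V.r y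

namespace VacantDoubleGroupoid

attribute [grind =] r_r r_s s_r s_s r_mul s_mul r_mul' s_mul'

variable {G : Type*} (D : VacantDoubleGroupoid G)

/-- The transposed double groupoid, in which the two directions are exchanged. -/
def swap : VacantDoubleGroupoid G where
  V := D.H
  H := D.V
  r_r x := (D.r_r x).symm
  r_s x := (D.s_r x).symm
  s_r x := (D.r_s x).symm
  s_s x := (D.s_s x).symm
  r_mul := D.r_mul'
  s_mul := D.s_mul'
  r_mul' := D.r_mul
  s_mul' := D.s_mul
  ext_rs x y h h' := D.ext_sr x y h' h
  ext_sr x y h h' := D.ext_rs x y h' h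
  fill_rs x y h := by
    obtain ⟨z, h1, h2⟩ := D.fill_sr y x h.symm
    exact ⟨z, h2, h1⟩
  fill_sr x y h := by
    obtain ⟨z, h1, h2⟩ := D.fill_rs y x h.symm
    exact ⟨z, h2, h1⟩

theorem interchange {a b c d : G} (h1 : D.H.s a = D.H.r b) (h2 : D.H.s c = D.H.r d)
    (h3 : D.V.s a = D.V.r c) (h4 : D.V.s b = D.V.r d) :
    D.V.mul (D.H.mul a b) (D.H.mul c d) = D.H.mul (D.V.mul a c) (D.V.mul b d) := by
  apply D.ext_rs <;> grind

@[grind =]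
theorem r_inv (x : G) : D.H.r (D.V.inv x) = D.V.inv (D.H.r x) := by
  apply D.V.eq_inv
  · rw [D.r_r]; grind
  · rw [← D.r_mul _ _ (by grind)]; grind

@[grind =]
theorem s_inv (x : G) : D.H.s (D.V.inv x) = D.V.inv (D.H.s x) := by
  apply D.V.eq_inv
  · rw [D.r_s]; grind
  · rw [← D.s_mul _ _ (by grind)]; grind

@[grind =]
theorem r_inv' (x : G) : D.V.r (D.H.inv x) = D.H.inv (D.V.r x) := D.swap.r_inv x

@[grind =]
theorem s_inv' (x : G) : D.V.s (D.H.inv x) = D.H.inv (D.V.s x) := D.swap.s_inv x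

theorem inv_comm (x : G) : D.V.inv (D.H.inv x) = D.H.inv (D.V.inv x) := by
  apply D.ext_rs <;> grind

theorem Hinv_Vmul {x y : G} (h : D.V.s x = D.V.r y) :
    D.H.inv (D.V.mul x y) = D.V.mul (D.H.inv x) (D.H.inv y) := by
  apply D.ext_rs <;> grind

theorem Vinv_Hmul {x y : G} (h : D.H.s x = D.H.r y) :
    D.V.inv (D.H.mul x y) = D.H.mul (D.V.inv x) (D.V.inv y) := D.swap.Hinv_Vmul h

theorem ext_rr {x y : G} (h : D.H.r x = D.H.r y) (h' : D.V.r x = D.V.r y) : x = y :=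
  D.V.inv_injective (D.ext_rs _ _ (by grind) (by grind))

theorem ext_ss {x y : G} (h : D.H.s x = D.H.s y) (h' : D.V.s x = D.V.s y) : x = y :=
  D.H.inv_injective (D.ext_rs _ _ (by grind) (by grind))

theorem fill_rr (x y : G) (h : D.V.r (D.H.r x) = D.H.r (D.V.r y)) :
    ∃ z, D.H.r z = D.H.r x ∧ D.V.r z = D.V.r y := by
  obtain ⟨z, h1, h2⟩ := D.fill_rs (D.V.inv x) (D.V.inv y) (by grind)
  exact ⟨D.V.inv z, by grind, by grind⟩

theorem fill_ss (x y : G) (h : D.V.s (D.H.s x) = D.H.s (D.V.s y)) :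
    ∃ z, D.H.s z = D.H.s x ∧ D.V.s z = D.V.s y := by
  obtain ⟨z, h1, h2⟩ := D.fill_rs (D.H.inv x) (D.H.inv y) (by grind)
  exact ⟨D.H.inv z, by grind, by grind⟩

/-- The inverse in both directions. -/
def inv (x : G) : G := D.V.inv (D.H.inv x)

theorem inv_inv (x : G) : D.inv (D.inv x) = x := by
  simp only [inv]
  grind [inv_comm]

/-- A square whose lower side is degenerate is a horizontal unit. -/
theorem Hunit_of_Vs {x : G} (h : D.H.r (D.V.s x) = D.V.s x) : D.H.r x = x := by
  apply D.ext_rs <;> grind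

/-- A square whose upper side is degenerate is a horizontal unit. -/
theorem Hunit_of_Vr {x : G} (h : D.H.r (D.V.r x) = D.V.r x) : D.H.r x = x := by
  apply D.ext_rr <;> grind

/-- Two factorizations of a square, one horizontal and one vertical, have a common refinement into
four squares

```
  a b
  c d
```
-/
theorem exists_factor {d1 d2 x y : G} (h1 : D.H.s d1 = D.H.r d2) (hxy : D.V.s x = D.V.r y)
    (h2 : D.H.mul d1 d2 = D.V.mul x y) :
    ∃ a b c d, D.H.s a = D.H.r b ∧ D.H.s c = D.H.r d ∧ D.V.s a = D.V.r c ∧ D.V.s b = D.V.r d ∧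
      D.H.mul a b = x ∧ D.H.mul c d = y ∧ D.V.mul a c = d1 ∧ D.V.mul b d = d2 := by
  have hr : D.H.r d1 = D.V.mul (D.H.r x) (D.H.r y) := by
    rw [← D.r_mul x y hxy, ← h2, D.H.r_mul d1 d2 h1]
  have hs : D.H.mul (D.V.s d1) (D.V.s d2) = D.V.s y := by
    rw [← D.s_mul' d1 d2 h1, h2, D.V.s_mul x y hxy]
  have hs' : D.H.s (D.V.s d1) = D.H.r (D.V.s d2) := by rw [← D.s_s, h1, D.s_r]
  -- the lower left square has the left side of `y` and the lower side of `d1`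
  obtain ⟨c1, k1, k2⟩ := D.fill_rs y d1 (by grind)
  have k3 : D.H.r (D.V.s d2) = D.H.s (D.V.s c1) := by grind
  have k4 : D.V.s (D.H.mul (D.H.inv c1) y) = D.V.s d2 := by
    rw [D.s_mul' _ _ (by grind), D.s_inv', k2, ← hs, D.H.inv_mul_cancel_left (by grind)]
  have k5 : D.H.mul c1 (D.H.mul (D.H.inv c1) y) = y := D.H.mul_inv_cancel_left k1
  have k6 : D.H.s c1 = D.H.r (D.H.mul (D.H.inv c1) y) := by grind
  generalize D.H.mul (D.H.inv c1) y = c2 at k4 k5 k6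
  refine ⟨D.V.mul d1 (D.V.inv c1), D.V.mul d2 (D.V.inv c2), c1, c2, by grind, k6, by grind,
    by grind, ?_, k5, by grind, by grind⟩
  rw [← D.interchange h1 (by grind) (by grind) (by grind), h2, ← D.Vinv_Hmul k6, k5]
  grind

end VacantDoubleGroupoid

/-! ### The weak Hopf C*-algebra of a vacant double groupoid -/

namespace VacantDoubleGroupoid

variable {G : Type*} {A B : Type*} [Ring A] [Algebra ℂ A] [Ring B] [Algebra ℂ B]

theorem basis_induction (e : Module.Basis G ℂ A) {p : A → Prop} (zero : p 0)
    (add : ∀ x y, p x → p y → p (x + y)) (smul : ∀ (c : ℂ) x, p x → p (c • x))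
    (basis : ∀ g, p (e g)) (x : A) : p x := by
  have hx : x ∈ Submodule.span ℂ (Set.range e) := e.mem_span x
  induction hx using Submodule.span_induction with
  | mem x h => obtain ⟨g, rfl⟩ := h; exact basis g
  | zero => exact zero
  | add x y _ _ hx hy => exact add x y hx hy
  | smul c x _ hx => exact smul c x hx

/-- The antipode: inversion of squares in both directions. -/
noncomputable def antipode (D : VacantDoubleGroupoid G) (e : Module.Basis G ℂ A) : A →ₗ[ℂ] A :=
  e.constr ℂ fun g => e (D.inv g)

theorem antipode_basis (D : VacantDoubleGroupoid G) (e : Module.Basis G ℂ A) (g : G) :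
    D.antipode e (e g) = e (D.inv g) :=
  e.constr_basis ..

variable [DecidableEq G] {e : Module.Basis G ℂ A} {f : Module.Basis G ℂ B}

/-- The bracket for which two bases indexed by the squares are dual to each other. -/
noncomputable def bracket (e : Module.Basis G ℂ A) (f : Module.Basis G ℂ B) : A →ₗ[ℂ] B →ₗ[ℂ] ℂ :=
  e.constr ℂ fun g => f.coord g

theorem bracket_basis (g g' : G) : bracket e f (e g) (f g') = if g = g' then 1 else 0 := by
  simp [bracket, Finsupp.single_apply, eq_comm]

theorem bracket_flip (a : A) (x : B) : bracket f e x a = bracket e f a x := by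
  induction a using basis_induction e with
  | zero => simp
  | add x x' hx hy => simp only [map_add, hx, hy, LinearMap.add_apply]
  | smul c x hx => simp only [map_smul, hx, LinearMap.smul_apply]
  | basis g =>
  induction x using basis_induction f with
  | zero => simp
  | add x x' hx hy => simp only [map_add, hx, hy, LinearMap.add_apply]
  | smul c x hx => simp only [map_smul, hx, LinearMap.smul_apply]
  | basis x =>
  simp only [bracket_basis, eq_comm]

variable (D : VacantDoubleGroupoid G)

/-- The counit: the characteristic function of the set of horizontal units. -/
noncomputable def counit (e : Module.Basis G ℂ A) : A →ₗ[ℂ] ℂ :=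
  e.constr ℂ fun g => if D.H.r g = g then 1 else 0

theorem counit_basis (e : Module.Basis G ℂ A) (g : G) :
    D.counit e (e g) = if D.H.r g = g then 1 else 0 :=
  e.constr_basis ..

variable [Fintype G]

/-- The factorizations `g = a b` of a square for the horizontal product. -/
def factorizations (g : G) : Finset (G × G) :=
  {p | D.H.s p.1 = D.H.r p.2 ∧ D.H.mul p.1 p.2 = g}

theorem mem_factorizations {g : G} {p : G × G} :
    p ∈ D.factorizations g ↔ D.H.s p.1 = D.H.r p.2 ∧ D.H.mul p.1 p.2 = g := by
  simp [factorizations]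

variable (e)

/-- The coproduct: a square is sent to the sum of its horizontal factorizations. -/
noncomputable def comul : A →ₗ[ℂ] A ⊗[ℂ] A :=
  e.constr ℂ fun g => ∑ p ∈ D.factorizations g, e p.1 ⊗ₜ[ℂ] e p.2

theorem comul_basis (g : G) :
    D.comul e (e g) = ∑ p ∈ D.factorizations g, e p.1 ⊗ₜ[ℂ] e p.2 :=
  e.constr_basis ..

theorem coassoc :
    TensorProduct.assoc ℂ A A A ∘ₗ (D.comul e).rTensor A ∘ₗ D.comul e =
      (D.comul e).lTensor A ∘ₗ D.comul e := by
  refine e.ext fun g => ?_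
  simp only [LinearMap.comp_apply, comul_basis, map_sum, LinearMap.rTensor_tmul,
    LinearMap.lTensor_tmul, TensorProduct.sum_tmul, TensorProduct.tmul_sum,
    LinearEquiv.coe_coe, TensorProduct.assoc_tmul]
  rw [Finset.sum_sigma', Finset.sum_sigma']
  refine Finset.sum_nbij'
    (fun q => ⟨(q.2.1, D.H.mul q.2.2 q.1.2), (q.2.2, q.1.2)⟩)
    (fun q => ⟨(D.H.mul q.1.1 q.2.1, q.2.2), (q.1.1, q.2.1)⟩) ?_ ?_ ?_ ?_ ?_
  · rintro ⟨⟨a, b⟩, ⟨c, d⟩⟩ h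
    simp only [Finset.mem_sigma, mem_factorizations] at h ⊢
    grind
  · rintro ⟨⟨a, b⟩, ⟨c, d⟩⟩ h
    simp only [Finset.mem_sigma, mem_factorizations] at h ⊢
    grind
  · rintro ⟨⟨a, b⟩, ⟨c, d⟩⟩ h
    simp only [Finset.mem_sigma, mem_factorizations] at h ⊢
    grind
  · rintro ⟨⟨a, b⟩, ⟨c, d⟩⟩ h
    simp only [Finset.mem_sigma, mem_factorizations] at h ⊢
    grind
  · rintro ⟨⟨a, b⟩, ⟨c, d⟩⟩ h
    rfl

theorem rTensor_counit_comp_comul :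
    (D.counit e).rTensor A ∘ₗ D.comul e = TensorProduct.mk ℂ ℂ A 1 := by
  refine e.ext fun g => ?_
  simp only [LinearMap.comp_apply, comul_basis, map_sum, LinearMap.rTensor_tmul, counit_basis,
    TensorProduct.mk_apply]
  rw [Finset.sum_eq_single (D.H.r g, g)]
  · rw [if_pos (D.H.r_r g)]
  · rintro ⟨a, b⟩ h h'
    rw [mem_factorizations] at h
    rw [if_neg, TensorProduct.zero_tmul]
    grind
  · intro h
    exact absurd (D.mem_factorizations.2 (by grind)) h

theorem lTensor_counit_comp_comul :
    (D.counit e).lTensor A ∘ₗ D.comul e = (TensorProduct.mk ℂ A ℂ).flip 1 := by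
  refine e.ext fun g => ?_
  simp only [LinearMap.comp_apply, comul_basis, map_sum, LinearMap.lTensor_tmul, counit_basis,
    TensorProduct.mk_apply, LinearMap.flip_apply]
  rw [Finset.sum_eq_single (g, D.H.s g)]
  · rw [if_pos (D.H.r_s g)]
  · rintro ⟨a, b⟩ h h'
    rw [mem_factorizations] at h
    rw [if_neg, TensorProduct.tmul_zero]
    grind
  · intro h
    exact absurd (D.mem_factorizations.2 (by grind)) h

variable {D e}

theorem antipode_comul (a : A) :
    TensorProduct.map (D.antipode e) (D.antipode e) (D.comul e a) =
      TensorProduct.comm ℂ A A (D.comul e (D.antipode e a)) := by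
  induction a using basis_induction e with
  | zero => simp
  | add x y hx hy => simp only [map_add, hx, hy]
  | smul c x hx => simp only [map_smul, hx]
  | basis x =>
  simp only [antipode_basis, comul_basis, map_sum, TensorProduct.map_tmul,
    TensorProduct.comm_tmul]
  have key : ∀ p x, p ∈ D.factorizations x →
      (D.inv p.2, D.inv p.1) ∈ D.factorizations (D.inv x) := by
    intro p x hp
    rw [mem_factorizations] at hp ⊢
    simp only [inv]
    refine ⟨by grind, ?_⟩
    rw [← D.Vinv_Hmul (by grind), ← D.H.inv_mul_rev hp.1, hp.2]
  refine Finset.sum_nbij' (fun p => (D.inv p.2, D.inv p.1)) (fun p => (D.inv p.2, D.inv p.1))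
    (fun p hp => key p x hp) (fun p hp => ?_) ?_ ?_ ?_
  · have := key p _ hp
    rwa [D.inv_inv] at this
  · intro p _
    simp only [D.inv_inv]
  · intro p _
    simp only [D.inv_inv]
  · intro p _
    rfl

/-- For dual bases, the coproduct by horizontal factorizations is dual to the horizontal
convolution product. -/
theorem bracket_comul (hf : ∀ x y, f x * f y = if D.H.s x = D.H.r y then f (D.H.mul x y) else 0)
    (a : A) (x y : B) :
    LinearMap.mul' ℂ ℂ (TensorProduct.map ((bracket e f).flip x) ((bracket e f).flip y)
      (D.comul e a)) = bracket e f a (x * y) := by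
  induction a using basis_induction e with
  | zero => simp
  | add x x' hx hy => simp only [map_add, hx, hy, LinearMap.add_apply]
  | smul c x hx => simp only [map_smul, hx, LinearMap.smul_apply]
  | basis g =>
  induction x using basis_induction f with
  | zero => simp
  | add x x' hx hy =>
    simp only [map_add, hx, hy, add_mul, TensorProduct.map_add_left, LinearMap.add_apply]
  | smul c x hx =>
    simp only [map_smul, hx, smul_mul_assoc, TensorProduct.map_smul_left, LinearMap.smul_apply]
  | basis x =>
  induction y using basis_induction f with
  | zero => simp
  | add x x' hx hy =>
    simp only [map_add, hx, hy, mul_add, TensorProduct.map_add_right, LinearMap.add_apply]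
  | smul c x hx =>
    simp only [map_smul, hx, mul_smul_comm, TensorProduct.map_smul_right, LinearMap.smul_apply]
  | basis y =>
  simp only [comul_basis, map_sum, TensorProduct.map_tmul, LinearMap.flip_apply, bracket_basis,
    LinearMap.mul'_apply, hf]
  have h0 : ∀ p ∈ D.factorizations g,
      (if p.1 = x then (1 : ℂ) else 0) * (if p.2 = y then 1 else 0) =
        if p = (x, y) then 1 else 0 := by
    rintro ⟨a, b⟩ _
    by_cases h1 : a = x <;> by_cases h2 : b = y <;> simp [h1, h2]
  rw [Finset.sum_congr rfl h0, Finset.sum_ite_eq']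
  simp only [mem_factorizations]
  by_cases h1 : D.H.s x = D.H.r y
  · simp only [h1, true_and, if_true, bracket_basis]
    simp only [eq_comm]
  · simp [h1]

theorem bracket_one (hf : (1 : B) = ∑ x, if D.H.r x = x then f x else 0) (a : A) :
    bracket e f a 1 = D.counit e a := by
  induction a using basis_induction e with
  | zero => simp
  | add x x' hx hy => simp only [map_add, hx, hy, LinearMap.add_apply]
  | smul c x hx => simp only [map_smul, hx, LinearMap.smul_apply]
  | basis g =>
  rw [hf, counit_basis, map_sum, Finset.sum_eq_single g]
  · split_ifs <;> simp [bracket_basis]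
  · intro x _ hx
    split_ifs <;> simp [bracket_basis, Ne.symm hx]
  · simp

variable [StarRing A]

/-- The basis `e`, indexed by the squares, identifies the `*`-algebra `A` with the convolution
algebra of the vertical groupoid. -/
structure IsConvolutionBasis (D : VacantDoubleGroupoid G) (e : Module.Basis G ℂ A) :
    Prop where
  mul : ∀ x y, e x * e y = if D.V.s x = D.V.r y then e (D.V.mul x y) else 0
  star : ∀ x, star (e x) = e (D.V.inv x)
  one : 1 = ∑ x, if D.V.r x = x then e x else 0

/-- When the composite of `x` over `y` is factorized horizontally, there is exactly one way of
factorizing `x` and `y` compatibly; this is the multiplicativity of the coproduct. -/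
theorem comul_mul (he : D.IsConvolutionBasis e) (a b : A) :
    D.comul e (a * b) = D.comul e a * D.comul e b := by
  induction a using basis_induction e with
  | zero => simp
  | add x y hx hy => simp only [add_mul, map_add, hx, hy]
  | smul c x hx => simp only [smul_mul_assoc, map_smul, hx]
  | basis x =>
  induction b using basis_induction e with
  | zero => simp
  | add x y hx hy => simp only [mul_add, map_add, hx, hy]
  | smul c x hx => simp only [mul_smul_comm, map_smul, hx]
  | basis y =>
  simp only [comul_basis, he.mul, Finset.sum_mul_sum, Algebra.TensorProduct.tmul_mul_tmul]
  by_cases hxy : D.V.s x = D.V.r y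
  · rw [if_pos hxy, comul_basis, ← Finset.sum_product']
    symm
    have h0 : ∀ q ∈ D.factorizations x ×ˢ D.factorizations y,
        ((if D.V.s q.1.1 = D.V.r q.2.1 then e (D.V.mul q.1.1 q.2.1) else 0) ⊗ₜ[ℂ]
          (if D.V.s q.1.2 = D.V.r q.2.2 then e (D.V.mul q.1.2 q.2.2) else 0)) =
        if D.V.s q.1.1 = D.V.r q.2.1 ∧ D.V.s q.1.2 = D.V.r q.2.2 then
          e (D.V.mul q.1.1 q.2.1) ⊗ₜ[ℂ] e (D.V.mul q.1.2 q.2.2) else 0 := by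
      intro q _
      by_cases h1 : D.V.s q.1.1 = D.V.r q.2.1 <;> by_cases h2 : D.V.s q.1.2 = D.V.r q.2.2 <;>
        simp [h1, h2]
    rw [Finset.sum_congr rfl h0, ← Finset.sum_filter]
    refine Finset.sum_nbij
      (fun q => (D.V.mul q.1.1 q.2.1, D.V.mul q.1.2 q.2.2)) ?_ ?_ ?_ ?_
    · rintro ⟨⟨a, b⟩, ⟨c, d⟩⟩ h
      simp only [Finset.mem_filter, Finset.mem_product, mem_factorizations] at h ⊢
      obtain ⟨⟨⟨h1, rfl⟩, h2, rfl⟩, h3, h4⟩ := h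
      rw [D.interchange h1 h2 h3 h4]
      grind
    · rintro ⟨⟨a, b⟩, ⟨c, d⟩⟩ h ⟨⟨a', b'⟩, ⟨c', d'⟩⟩ h' E
      -- `c` is determined by its left and lower sides, `d` by its right and lower sides
      simp only [Finset.coe_filter, Set.mem_ofPred_eq, Finset.mem_product,
        mem_factorizations, Prod.mk.injEq] at h h' E ⊢
      have hc : c = c' := by
        refine D.ext_rs _ _ ?_ ?_
        · rw [← D.H.r_mul c d h.1.2.1, h.1.2.2, ← h'.1.2.2, D.H.r_mul c' d' h'.1.2.1]
        · rw [← D.V.s_mul a c h.2.1, E.1, D.V.s_mul a' c' h'.2.1]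
      have hd : d = d' := by
        refine D.ext_ss ?_ ?_
        · rw [← D.H.s_mul c d h.1.2.1, h.1.2.2, ← h'.1.2.2, D.H.s_mul c' d' h'.1.2.1]
        · rw [← D.V.s_mul b d h.2.2, E.2, D.V.s_mul b' d' h'.2.2]
      subst hc hd
      have ha : a = a' := D.V.mul_right_cancel h.2.1 h'.2.1 E.1
      have hb : b = b' := D.V.mul_right_cancel h.2.2 h'.2.2 E.2
      exact ⟨⟨ha, hb⟩, rfl, rfl⟩
    · rintro ⟨d1, d2⟩ h
      simp only [Finset.mem_coe, mem_factorizations] at h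
      obtain ⟨h1, h2⟩ := h
      obtain ⟨a, b, c, d, ha, hc, h3, h4, ea, ec, e1, e2⟩ := D.exists_factor h1 hxy h2
      refine ⟨((a, b), (c, d)), ?_, ?_⟩
      · simp only [Finset.coe_filter, Set.mem_ofPred_eq, Finset.mem_product, mem_factorizations]
        exact ⟨⟨⟨ha, ea⟩, hc, ec⟩, h3, h4⟩
      · rw [← e1, ← e2]
    · rintro ⟨⟨a, b⟩, ⟨c, d⟩⟩ h
      rfl
  · rw [if_neg hxy, map_zero]
    symm
    refine Finset.sum_eq_zero fun p hp => Finset.sum_eq_zero fun q hq => ?_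
    rw [mem_factorizations] at hp hq
    by_cases h1 : D.V.s p.1 = D.V.r q.1
    · rw [if_neg (c := D.V.s p.2 = D.V.r q.2), TensorProduct.tmul_zero]
      grind
    · rw [if_neg h1, TensorProduct.zero_tmul]

theorem antipode_mul (he : D.IsConvolutionBasis e) (a b : A) :
    D.antipode e (a * b) = D.antipode e b * D.antipode e a := by
  induction a using basis_induction e with
  | zero => simp
  | add x y hx hy => simp only [add_mul, mul_add, map_add, hx, hy]
  | smul c x hx => simp only [smul_mul_assoc, mul_smul_comm, map_smul, hx]
  | basis x =>
  induction b using basis_induction e with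
  | zero => simp
  | add x y hx hy => simp only [add_mul, mul_add, map_add, hx, hy]
  | smul c x hx => simp only [smul_mul_assoc, mul_smul_comm, map_smul, hx]
  | basis y =>
  simp only [he.mul, antipode_basis, inv]
  by_cases h : D.V.s x = D.V.r y
  · rw [if_pos h, if_pos (by grind), antipode_basis, inv, D.Hinv_Vmul h,
      D.V.inv_mul_rev (by grind)]
  · rw [if_neg h, if_neg (by grind [D.H.inv_injective.eq_iff]), map_zero]

variable [StarModule ℂ A]

theorem comul_star (he : D.IsConvolutionBasis e) (a : A) :
    D.comul e (star a) = star (D.comul e a) := by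
  induction a using basis_induction e with
  | zero => simp
  | add x y hx hy => simp only [star_add, map_add, hx, hy]
  | smul c x hx => simp only [star_smul, map_smul, hx]
  | basis x =>
  simp only [he.star, comul_basis, star_sum, TensorProduct.star_tmul]
  refine Finset.sum_nbij' (fun p => (D.V.inv p.1, D.V.inv p.2))
    (fun p => (D.V.inv p.1, D.V.inv p.2)) ?_ ?_ ?_ ?_ ?_
  · intro p hp
    rw [mem_factorizations] at hp ⊢
    refine ⟨by grind, ?_⟩
    rw [← D.Vinv_Hmul hp.1]; grind
  · intro p hp
    rw [mem_factorizations] at hp ⊢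
    refine ⟨by grind, ?_⟩
    rw [← D.Vinv_Hmul hp.1]; grind
  · intro p _
    simp only [D.V.inv_inv]
  · intro p _
    simp only [D.V.inv_inv]
  · intro p _
    simp only [D.V.inv_inv]

theorem antipode_star (he : D.IsConvolutionBasis e) (a : A) :
    D.antipode e (star (D.antipode e (star a))) = a := by
  induction a using basis_induction e with
  | zero => simp
  | add x y hx hy => simp only [star_add, map_add, hx, hy]
  | smul c x hx => simp only [star_smul, map_smul, hx, star_star]
  | basis x =>
  simp only [he.star, antipode_basis, inv]
  grind [inv_comm]

end VacantDoubleGroupoid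

namespace VacantDoubleGroupoid

variable {G : Type*} [Fintype G] [DecidableEq G] {D : VacantDoubleGroupoid G}
variable {A : Type*} [Ring A] [StarRing A] [Algebra ℂ A]
variable {e : Module.Basis G ℂ A}

theorem basis_mul_unit (he : D.IsConvolutionBasis e) (x : G) {w : G} (hw : D.V.r w = w) :
    e x * e w = if D.V.s x = w then e x else 0 := by
  rw [he.mul, hw]
  split_ifs with h
  · rw [← h, D.V.mul_s_self]
  · rfl

theorem unit_mul_basis (he : D.IsConvolutionBasis e) (x : G) {w : G} (hw : D.V.r w = w) :
    e w * e x = if D.V.r x = w then e x else 0 := by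
  rw [he.mul, show D.V.s w = w by grind]
  by_cases h : D.V.r x = w
  · rw [if_pos h, if_pos h.symm, ← h, D.V.r_mul_self]
  · rw [if_neg h, if_neg (Ne.symm h)]

/-- The horizontal factors of a vertical unit are vertical units. -/
theorem comul_one (he : D.IsConvolutionBasis e) :
    D.comul e 1 = ∑ p : G × G with D.V.r p.1 = p.1 ∧ D.V.r p.2 = p.2 ∧ D.H.s p.1 = D.H.r p.2,
      e p.1 ⊗ₜ[ℂ] e p.2 := by
  rw [he.one, ← Finset.sum_filter, map_sum]
  simp only [comul_basis]
  rw [Finset.sum_sigma']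
  refine Finset.sum_nbij' (fun q => q.2) (fun p => ⟨D.H.mul p.1 p.2, p⟩) ?_ ?_ ?_ ?_ ?_
  · rintro ⟨w, a, b⟩ h
    simp only [Finset.mem_sigma, mem_factorizations, Finset.mem_filter, Finset.mem_univ,
      true_and] at h ⊢
    obtain ⟨hw, h1, h2⟩ := h
    -- a horizontal factor of a vertical unit is a vertical unit, since its left side is one
    have ha : D.V.r a = a := D.swap.Hunit_of_Vr (x := a) (by
      change D.V.r (D.H.r a) = D.H.r a
      rw [← D.H.r_mul a b h1, h2, D.r_r, hw])
    have hb : D.V.r b = b := D.swap.Hunit_of_Vr (x := b) (by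
      change D.V.r (D.H.r b) = D.H.r b
      rw [← h1, D.r_s, ha])
    exact ⟨ha, hb, h1⟩
  · rintro ⟨a, b⟩ h
    simp only [Finset.mem_sigma, mem_factorizations, Finset.mem_filter, Finset.mem_univ,
      true_and, and_true] at h ⊢
    exact ⟨by rw [D.r_mul' _ _ h.2.2, h.1, h.2.1], h.2.2⟩
  · rintro ⟨w, a, b⟩ h
    simp only [Finset.mem_sigma, mem_factorizations] at h ⊢
    rw [h.2.2]
  · rintro ⟨a, b⟩ _
    rfl
  · rintro ⟨w, a, b⟩ _
    rfl

/-- The convolution `(κ ⋆ id)` of a square vanishes unless the square is a horizontal unit. -/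
theorem antipode_convolution (he : D.IsConvolutionBasis e) (c : G) :
    ∑ q ∈ D.factorizations c, e (D.inv q.1) * e q.2 =
      if D.H.r c = c then ∑ a with D.H.r a = c, e (D.V.s (D.H.inv a)) else 0 := by
  split_ifs with hc
  · refine Finset.sum_nbij' (fun q => q.1) (fun a => (a, D.H.inv a)) ?_ ?_ ?_ ?_ ?_
    · rintro ⟨a, b⟩ h
      simp only [mem_factorizations, Finset.mem_filter, Finset.mem_univ, true_and] at h ⊢
      rw [← D.H.r_mul a b h.1, h.2, hc]
    · intro a h
      simp only [mem_factorizations, Finset.mem_filter, Finset.mem_univ, true_and] at h ⊢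
      grind
    · rintro ⟨a, b⟩ h
      rw [mem_factorizations] at h
      simp only [Prod.mk.injEq, true_and]
      exact (D.H.eq_inv h.1 (by rw [← D.H.r_mul a b h.1, h.2, hc])).symm
    · intro a _
      rfl
    · rintro ⟨a, b⟩ h
      rw [mem_factorizations] at h
      obtain rfl : b = D.H.inv a :=
        D.H.eq_inv h.1 (by rw [← D.H.r_mul a b h.1, h.2, hc])
      simp only [he.mul, inv, D.V.s_inv, if_true, D.V.inv_mul]
  · refine Finset.sum_eq_zero ?_
    rintro ⟨a, b⟩ h
    rw [mem_factorizations] at h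
    simp only [he.mul, inv, D.V.s_inv]
    rw [if_neg]
    intro h'
    refine hc (D.Hunit_of_Vr ?_)
    rw [← h.2, D.r_mul' _ _ h.1, ← h', D.r_inv', D.H.mul_inv, D.H.r_r]

/-- Only the factorization of a square `g` into a horizontal unit and `g` contributes to the left
hand side, and the sum over the squares `a` with the left side of `g` becomes one over the
degenerate squares that are the lower sides of the horizontal inverses of the `a`. -/
theorem antipode_axiom (he : D.IsConvolutionBasis e) (x : A) :
    (LinearMap.mul' ℂ A ∘ₗ (D.antipode e).rTensor A).rTensor A
      ((D.comul e).rTensor A (D.comul e x)) = ((1 : A) ⊗ₜ[ℂ] x) * D.comul e 1 := by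
  induction x using basis_induction e with
  | zero => simp
  | add x y hx hy => simp only [map_add, hx, hy, TensorProduct.tmul_add, add_mul]
  | smul c x hx => simp only [map_smul, hx, TensorProduct.tmul_smul, smul_mul_assoc]
  | basis g =>
  simp only [comul_basis, map_sum, LinearMap.rTensor_tmul, LinearMap.comp_apply,
    antipode_basis, LinearMap.mul'_apply, antipode_convolution he]
  rw [Finset.sum_eq_single (D.H.r g, g)]
  rotate_left
  · rintro ⟨a, b⟩ h h'
    rw [mem_factorizations] at h
    rw [if_neg, TensorProduct.zero_tmul]
    grind
  · intro h
    exact absurd (D.mem_factorizations.2 (by grind)) h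
  rw [if_pos (D.H.r_r g), comul_one he, Finset.mul_sum, TensorProduct.sum_tmul]
  simp only [Algebra.TensorProduct.tmul_mul_tmul, one_mul]
  have h0 : ∀ p ∈ (Finset.univ.filter fun p : G × G => D.V.r p.1 = p.1 ∧ D.V.r p.2 = p.2 ∧
      D.H.s p.1 = D.H.r p.2), e p.1 ⊗ₜ[ℂ] (e g * e p.2) =
      if D.V.s g = p.2 then e p.1 ⊗ₜ[ℂ] e g else 0 := by
    intro p hp
    rw [basis_mul_unit he g (by grind)]
    split_ifs
    · rfl
    · exact TensorProduct.tmul_zero _ _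
  rw [Finset.sum_congr rfl h0, ← Finset.sum_filter]
  refine Finset.sum_nbij (fun a => (D.V.s (D.H.inv a), D.V.s g)) ?_ ?_ ?_ ?_
  · intro a h
    simp only [Finset.mem_filter, Finset.mem_univ, true_and, and_true] at h ⊢
    refine ⟨D.V.r_s _, D.V.r_s _, ?_⟩
    rw [← D.s_s, D.H.s_inv, h, D.s_r]
  · intro a h b h' E
    simp only [Finset.coe_filter, Finset.mem_univ, true_and, Set.mem_ofPred_eq,
      Prod.mk.injEq, and_true] at h h' E
    rw [D.s_inv', D.s_inv'] at E
    exact D.ext_rs _ _ (h.trans h'.symm) (D.H.inv_injective E)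
  · rintro ⟨w, w'⟩ h
    simp only [Finset.coe_filter, Finset.mem_filter, Finset.mem_univ, true_and,
      Set.mem_ofPred_eq] at h
    obtain ⟨⟨h1, h2, h3⟩, rfl⟩ := h
    have h4 : D.V.s w = w := by grind
    -- every degenerate square `w` that fits is attained, since left and lower sides are arbitrary
    obtain ⟨z, k1, k2⟩ := D.fill_rs g (D.H.inv w) (by grind)
    refine ⟨z, by simpa using k1, ?_⟩
    simp only [Prod.mk.injEq, and_true]
    grind
  · intro a _
    rfl

theorem counit_mul (he : D.IsConvolutionBasis e) (x y : A) :
    LinearMap.mul' ℂ ℂ (TensorProduct.map (D.counit e) (D.counit e)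
      ((x ⊗ₜ[ℂ] (1 : A)) * D.comul e 1 * ((1 : A) ⊗ₜ[ℂ] y))) = D.counit e (x * y) := by
  induction x using basis_induction e with
  | zero => simp
  | add x x' hx hy => simp only [TensorProduct.add_tmul, add_mul, map_add, hx, hy]
  | smul c x hx => simp only [← TensorProduct.smul_tmul', smul_mul_assoc, map_smul, hx]
  | basis x =>
  induction y using basis_induction e with
  | zero => simp
  | add y y' hx hy => simp only [TensorProduct.tmul_add, mul_add, map_add, hx, hy]
  | smul c y hx => simp only [TensorProduct.tmul_smul, mul_smul_comm, map_smul, hx]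
  | basis y =>
  simp only [comul_one he, Finset.mul_sum, Finset.sum_mul, Algebra.TensorProduct.tmul_mul_tmul,
    one_mul, mul_one, map_sum, TensorProduct.map_tmul, LinearMap.mul'_apply]
  have h0 : ∀ p ∈ (Finset.univ.filter fun p : G × G => D.V.r p.1 = p.1 ∧ D.V.r p.2 = p.2 ∧
      D.H.s p.1 = D.H.r p.2), D.counit e (e x * e p.1) * D.counit e (e p.2 * e y) =
      if p = (D.V.s x, D.V.r y) then D.counit e (e x) * D.counit e (e y) else 0 := by
    rintro ⟨a, b⟩ hp
    rw [basis_mul_unit he x (by grind), unit_mul_basis he y (by grind)]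
    by_cases h1 : D.V.s x = a <;> by_cases h2 : D.V.r y = b <;>
      simp [h1, h2, @eq_comm G a, @eq_comm G b]
  rw [Finset.sum_congr rfl h0, Finset.sum_ite_eq', counit_basis, counit_basis, he.mul]
  simp only [Finset.mem_filter, Finset.mem_univ, true_and, D.V.r_s, D.V.r_r]
  by_cases hxy : D.V.s x = D.V.r y
  · rw [if_pos hxy, counit_basis]
    by_cases hy : D.H.r y = y
    · have hx : D.H.r x = x := D.Hunit_of_Vs (by rw [hxy, ← D.r_r, hy])
      rw [if_pos, if_pos hx, if_pos hy, if_pos, one_mul]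
      · rw [D.r_mul _ _ hxy, hx, hy]
      · rw [hxy, ← hy]; grind
    · rw [if_neg hy, mul_zero, ite_self, if_neg]
      intro h
      refine hy (D.Hunit_of_Vs ?_)
      rw [← D.V.s_mul x y hxy, ← D.s_r, h]
  · rw [if_neg hxy, map_zero]
    split_ifs with h h1 h2 <;> simp
    apply hxy
    have k1 : D.H.s (D.V.s x) = D.V.s x := by rw [← D.s_s, ← h1, D.H.s_r]
    rw [← k1, h, ← D.r_r, h2]

variable [StarModule ℂ A]

/-- The counit is a sum of positive forms: with `T u a` the sum of the coefficients of `a` at the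
horizontal units with upper side `u`, one has `ε(a* b) = ∑ u, conj (T u a) * T u b`. -/
theorem counit_star_mul (he : D.IsConvolutionBasis e) :
    ∃ T : G → A →ₗ[ℂ] ℂ, ∀ a b, D.counit e (star a * b) = ∑ u, star (T u a) * T u b := by
  refine ⟨fun u => e.constr ℂ fun g => if D.H.r g = g ∧ D.V.r g = u then 1 else 0,
    fun a b => ?_⟩
  induction a using basis_induction e with
  | zero => simp
  | add x y hx hy => simp only [star_add, add_mul, map_add, hx, hy, Finset.sum_add_distrib]
  | smul c x hx =>
    simp only [star_smul, smul_mul_assoc, map_smul, hx, smul_eq_mul, star_mul', mul_assoc,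
      Finset.mul_sum]
  | basis x =>
  induction b using basis_induction e with
  | zero => simp
  | add x y hx hy => simp only [mul_add, map_add, hx, hy, Finset.sum_add_distrib]
  | smul c x hx =>
    simp only [mul_smul_comm, map_smul, hx, smul_eq_mul, mul_left_comm _ c, Finset.mul_sum]
  | basis y =>
  simp only [e.constr_basis, he.star, he.mul, D.V.s_inv]
  by_cases hx : D.H.r x = x
  · rw [Finset.sum_eq_single (D.V.r x) (fun u _ hu => by simp [hu.symm]) (by simp)]
    by_cases hxy : D.V.r x = D.V.r y
    · rw [if_pos hxy, counit_basis]
      by_cases hy : D.H.r y = y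
      · rw [if_pos (by rw [D.r_mul _ _ (by grind), D.r_inv, hx, hy])]
        simp [hx, hy, hxy]
      · rw [if_neg]
        · simp [hy]
        · intro h
          exact hy (D.Hunit_of_Vr (by rw [← hxy, ← D.r_r, hx]))
    · simp [hxy, Ne.symm hxy]
  · rw [Finset.sum_eq_zero (fun u _ => by simp [hx])]
    split_ifs with hxy
    · rw [counit_basis, if_neg]
      intro h
      refine hx (D.Hunit_of_Vr ?_)
      rw [hxy]
      -- the lower side of a horizontal unit is degenerate, hence so is `y`
      have hy : D.H.r y = y := D.Hunit_of_Vs (by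
        rw [← D.V.s_mul (D.V.inv x) y (by grind), ← D.s_r, h])
      rw [← D.r_r, hy]
    · exact map_zero _

theorem counit_nonneg (he : D.IsConvolutionBasis e) (x : A) : 0 ≤ D.counit e (star x * x) := by
  obtain ⟨T, hT⟩ := counit_star_mul he
  rw [hT]
  exact Finset.sum_nonneg fun u _ => star_mul_self_nonneg _

/-- The weak Hopf C*-algebra of a vacant double groupoid: the convolution algebra of the vertical
groupoid, with the coproduct dual to the convolution product of the horizontal one. -/
noncomputable def weakHopf (he : D.IsConvolutionBasis e)
    (hA : ∃ (n : ℕ) (π : A →⋆ₐ[ℂ] Matrix (Fin n) (Fin n) ℂ), Function.Injective π) :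
    WeakHopfCStar A where
  comul := D.comul e
  counit := D.counit e
  coassoc := D.coassoc e
  rTensor_counit_comp_comul := D.rTensor_counit_comp_comul e
  lTensor_counit_comp_comul := D.lTensor_counit_comp_comul e
  exists_faithful_rep := hA
  comul_mul := comul_mul he
  comul_star := comul_star he
  antipode := D.antipode e
  antipode_star := antipode_star he
  antipode_mul := antipode_mul he
  antipode_comul := antipode_comul
  antipode_axiom := antipode_axiom he
  counit_nonneg := counit_nonneg he
  counit_mul := counit_mul he

/-! ### Duality between a vacant double groupoid and its transpose -/

variable {B : Type*} [Ring B] [StarRing B] [Algebra ℂ B] [StarModule ℂ B] {f : Module.Basis G ℂ B}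

theorem isDuality (he : D.IsConvolutionBasis e) (hf : D.swap.IsConvolutionBasis f)
    (hA : ∃ (n : ℕ) (π : A →⋆ₐ[ℂ] Matrix (Fin n) (Fin n) ℂ), Function.Injective π)
    (hB : ∃ (n : ℕ) (π : B →⋆ₐ[ℂ] Matrix (Fin n) (Fin n) ℂ), Function.Injective π) :
    IsDuality (weakHopf he hA) (weakHopf hf hB) (bracket e f) where
  nondegenerate := by
    constructor
    · intro a h
      refine e.ext_elem fun g => ?_
      have := h (f g)
      rw [← bracket_flip] at this
      simpa [bracket] using this
    · intro x h
      refine f.ext_elem fun g => ?_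
      have := h (e g)
      simpa [bracket] using this
  comul_left a x y := bracket_comul (D := D) hf.mul a x y
  comul_right a b x := by
    have := bracket_comul (D := D.swap) (e := f) (f := e) he.mul x a b
    rw [bracket_flip] at this
    rw [← this]
    congr 3 <;> ext <;> exact (bracket_flip _ _).symm
  counit_left a := bracket_one hf.one a
  counit_right x := by
    rw [← bracket_flip]
    exact bracket_one (D := D.swap) he.one x
  antipode a x := by
    change bracket e f (D.antipode e a) x = bracket e f a (D.swap.antipode f x)
    induction a using basis_induction e with
    | zero => simp
    | add x x' hx hy => simp only [map_add, hx, hy, LinearMap.add_apply]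
    | smul c x hx => simp only [map_smul, hx, LinearMap.smul_apply]
    | basis g =>
    induction x using basis_induction f with
    | zero => simp
    | add x x' hx hy => simp only [map_add, hx, hy]
    | smul c x hx => simp only [map_smul, hx]
    | basis x =>
    have hinv : D.swap.inv x = D.inv x := (D.inv_comm x).symm
    simp only [antipode_basis, bracket_basis, hinv]
    congr 1
    rw [eq_iff_iff]
    constructor
    · rintro rfl; exact (D.inv_inv g).symm
    · rintro rfl; exact D.inv_inv x
  star_left a x := by
    change bracket e f (star a) x = star (bracket e f a (star (D.swap.antipode f x)))
    induction a using basis_induction e with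
    | zero => simp
    | add x x' hx hy => simp only [star_add, map_add, hx, hy, LinearMap.add_apply]
    | smul c x hx => simp only [star_smul, map_smul, hx, LinearMap.smul_apply]
    | basis g =>
    induction x using basis_induction f with
    | zero => simp
    | add x x' hx hy => simp only [star_add, map_add, hx, hy]
    | smul c x hx => simp only [star_smul, map_smul, hx, star_star]
    | basis x =>
    have hinv : D.swap.V.inv (D.swap.inv x) = D.V.inv x := by
      change D.H.inv (D.H.inv (D.V.inv x)) = _
      exact D.H.inv_inv _
    simp only [antipode_basis, he.star, hf.star, hinv, bracket_basis]
    rw [apply_ite star, star_one, star_zero]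
    congr 1
    rw [eq_iff_iff]
    constructor
    · rintro rfl; exact (D.V.inv_inv g).symm
    · rintro rfl; exact D.V.inv_inv x

end VacantDoubleGroupoid

/-! ### The double groupoid of a matched pair -/

namespace Arr

variable {C : Type u} [Groupoid.{v} C]

attribute [grind =] s_mul r_mul assoc unit_mul mul_unit inv_mul mul_inv s_inv r_inv
attribute [grind →] MemOf.inv

@[grind =]
theorem r_unit (a : C) : (unit a).r = a := rfl

@[grind =]
theorem inv_mul_cancel_left {x y : Arr C} (h : x.s = y.r) : x⁻¹ * (x * y) = y := by
  rw [← assoc (s_inv x) h, inv_mul, h, unit_mul]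

@[grind =]
theorem mul_inv_cancel_left {x y : Arr C} (h : x.r = y.r) : x * (x⁻¹ * y) = y := by
  rw [← assoc (r_inv x).symm h, mul_inv, h, unit_mul]

@[grind =]
theorem mul_inv_cancel_right {x y : Arr C} (h : x.s = y.r) : x * y * y⁻¹ = x := by
  rw [assoc h (r_inv y).symm, mul_inv, ← h, mul_unit]

@[grind =]
theorem inv_inv (x : Arr C) : x⁻¹⁻¹ = x := by
  rw [← mul_unit x⁻¹⁻¹, s_inv, r_inv, ← inv_mul x, inv_mul_cancel_left (s_inv x)]

theorem eq_inv_mul {x y z : Arr C} (h : x.s = y.r) (e : x * y = z) : y = x⁻¹ * z := by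
  rw [← e, inv_mul_cancel_left h]

theorem eq_mul_inv {x y z : Arr C} (h : x.s = y.r) (e : x * y = z) : x = z * y⁻¹ := by
  rw [← e, mul_inv_cancel_right h]

@[grind =]
theorem mul_inv_rev {x y : Arr C} (h : x.s = y.r) : (x * y)⁻¹ = y⁻¹ * x⁻¹ := by
  have h1 : (x * y) * (y⁻¹ * x⁻¹) = unit x.r := by grind
  have h2 := eq_inv_mul (x := x * y) (by grind) h1
  rw [h2, ← r_mul h, ← s_inv (x * y), mul_unit]

end Arr

namespace MatchPair

open Arr

variable {C : Type u} [Groupoid.{v} C] (P : MatchPair C)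

/-- The matched pair with `H` and `K` exchanged; it gives the decomposition of an arrow as an
element of `K` times an element of `H`. -/
def swap : MatchPair C where
  H := P.K
  K := P.H
  exists_eq_mul g := by
    obtain ⟨h, k, hh, hk, hs, e⟩ := P.exists_eq_mul g⁻¹
    refine ⟨k⁻¹, h⁻¹, hk.inv, hh.inv, hs.symm, ?_⟩
    rw [← mul_inv_rev hs, ← e, Arr.inv_inv]
  inter g hK hH := P.inter g hH hK

/-- The `K`-component of `g = q₁ q₂`, `q₁ ∈ K`, `q₂ ∈ H`. -/
noncomputable def q₁ (g : Arr C) : Arr C := P.swap.p₁ g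

/-- The `H`-component of `g = q₁ q₂`, `q₁ ∈ K`, `q₂ ∈ H`. -/
noncomputable def q₂ (g : Arr C) : Arr C := P.swap.p₂ g

@[grind .]
theorem q₁_mem (g : Arr C) : (P.q₁ g).MemOf P.K := P.swap.p₁_mem g

@[grind .]
theorem q₂_mem (g : Arr C) : (P.q₂ g).MemOf P.H := P.swap.p₂_mem g

@[grind =]
theorem s_q₁ (g : Arr C) : (P.q₁ g).s = (P.q₂ g).r := P.swap.s_p₁ g

@[grind =]
theorem r_q₁ (g : Arr C) : (P.q₁ g).r = g.r := P.swap.r_p₁ g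

@[grind =]
theorem s_q₂ (g : Arr C) : (P.q₂ g).s = g.s := P.swap.s_p₂ g

@[grind =]
theorem q₁_mul_q₂ (g : Arr C) : P.q₁ g * P.q₂ g = g := (P.swap.eq_p₁_mul_p₂ g).symm

@[grind =]
theorem p₁_mul_p₂ (g : Arr C) : P.p₁ g * P.p₂ g = g := (P.eq_p₁_mul_p₂ g).symm

attribute [grind .] p₁_mem p₂_mem
attribute [grind =] s_p₁ r_p₁ s_p₂

theorem p_mul_left {h y : Arr C} (hh : h.MemOf P.H) (hs : h.s = y.r) :
    P.p₁ (h * y) = h * P.p₁ y ∧ P.p₂ (h * y) = P.p₂ y := by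
  have e : h * y = h * P.p₁ y * P.p₂ y := by grind
  rw [e]
  exact P.p_unique (hh.mul (P.p₁_mem y) (by grind)) (P.p₂_mem y) (by grind)

theorem p_mul_right {y k : Arr C} (hk : k.MemOf P.K) (hs : y.s = k.r) :
    P.p₁ (y * k) = P.p₁ y ∧ P.p₂ (y * k) = P.p₂ y * k := by
  have e : y * k = P.p₁ y * (P.p₂ y * k) := by
    rw [← assoc (P.s_p₁ y) (by grind), P.p₁_mul_p₂]
  rw [e]
  exact P.p_unique (P.p₁_mem y) ((P.p₂_mem y).mul hk (by grind)) (by grind)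

@[grind =]
theorem p₁_mul_left {h y : Arr C} (hh : h.MemOf P.H) (hs : h.s = y.r) :
    P.p₁ (h * y) = h * P.p₁ y := (P.p_mul_left hh hs).1

@[grind =]
theorem p₂_mul_left {h y : Arr C} (hh : h.MemOf P.H) (hs : h.s = y.r) :
    P.p₂ (h * y) = P.p₂ y := (P.p_mul_left hh hs).2

@[grind =]
theorem p₁_mul_right {y k : Arr C} (hk : k.MemOf P.K) (hs : y.s = k.r) :
    P.p₁ (y * k) = P.p₁ y := (P.p_mul_right hk hs).1

@[grind =]
theorem p₂_mul_right {y k : Arr C} (hk : k.MemOf P.K) (hs : y.s = k.r) :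
    P.p₂ (y * k) = P.p₂ y * k := (P.p_mul_right hk hs).2

@[grind =]
theorem q₁_mul_left {k y : Arr C} (hk : k.MemOf P.K) (hs : k.s = y.r) :
    P.q₁ (k * y) = k * P.q₁ y := P.swap.p₁_mul_left hk hs

@[grind =]
theorem q₂_mul_left {k y : Arr C} (hk : k.MemOf P.K) (hs : k.s = y.r) :
    P.q₂ (k * y) = P.q₂ y := P.swap.p₂_mul_left hk hs

@[grind =]
theorem q₁_mul_right {y h : Arr C} (hh : h.MemOf P.H) (hs : y.s = h.r) :
    P.q₁ (y * h) = P.q₁ y := P.swap.p₁_mul_right hh hs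

@[grind =]
theorem q₂_mul_right {y h : Arr C} (hh : h.MemOf P.H) (hs : y.s = h.r) :
    P.q₂ (y * h) = P.q₂ y * h := P.swap.p₂_mul_right hh hs

@[grind =]
theorem p₁_of_mem_H {h : Arr C} (hh : h.MemOf P.H) : P.p₁ h = h := by
  conv_lhs => rw [← mul_unit h]
  exact P.p₁_mul hh (P.unit_mem_K _) rfl

@[grind =]
theorem p₂_of_mem_H {h : Arr C} (hh : h.MemOf P.H) : P.p₂ h = unit h.s := by
  conv_lhs => rw [← mul_unit h]
  exact P.p₂_mul hh (P.unit_mem_K _) rfl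

@[grind =]
theorem p₁_of_mem_K {k : Arr C} (hk : k.MemOf P.K) : P.p₁ k = unit k.r := by
  conv_lhs => rw [← unit_mul k]
  exact P.p₁_mul (P.unit_mem_H _) hk rfl

@[grind =]
theorem p₂_of_mem_K {k : Arr C} (hk : k.MemOf P.K) : P.p₂ k = k := by
  conv_lhs => rw [← unit_mul k]
  exact P.p₂_mul (P.unit_mem_H _) hk rfl

@[grind =]
theorem q₁_of_mem_K {k : Arr C} (hk : k.MemOf P.K) : P.q₁ k = k := P.swap.p₁_of_mem_H hk

@[grind =]
theorem q₂_of_mem_K {k : Arr C} (hk : k.MemOf P.K) : P.q₂ k = unit k.s := P.swap.p₂_of_mem_H hk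

@[grind =]
theorem q₁_of_mem_H {h : Arr C} (hh : h.MemOf P.H) : P.q₁ h = unit h.r := P.swap.p₁_of_mem_K hh

@[grind =]
theorem q₂_of_mem_H {h : Arr C} (hh : h.MemOf P.H) : P.q₂ h = h := P.swap.p₂_of_mem_K hh

/-- When `x` stands above `y`, so that `q₁ x * y` is their composite square, the right sides compose
as well. -/
theorem q₁_mul_eq {x y : Arr C} (h : P.q₂ x = P.p₁ y) : P.q₁ x * y = x * P.p₂ y := by
  calc P.q₁ x * y = P.q₁ x * (P.p₁ y * P.p₂ y) := by rw [P.p₁_mul_p₂]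
    _ = P.q₁ x * P.q₂ x * P.p₂ y := by rw [← h, assoc (P.s_q₁ x) (by rw [h, P.s_p₁])]
    _ = x * P.p₂ y := by rw [P.q₁_mul_q₂]

/-- Right and left sides of a square: `q₁⁻¹ p₁ = q₂ p₂⁻¹`. -/
theorem q₁_inv_mul_p₁ (x : Arr C) : (P.q₁ x)⁻¹ * P.p₁ x = P.q₂ x * (P.p₂ x)⁻¹ := by
  have h : P.q₁ x * (P.q₂ x * (P.p₂ x)⁻¹) = P.p₁ x := by
    rw [← assoc (P.s_q₁ x) (by grind), P.q₁_mul_q₂]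
    exact (eq_mul_inv (P.s_p₁ x) (P.p₁_mul_p₂ x)).symm
  exact (eq_inv_mul (by grind) h).symm

/-- The arrow `g = p₁ g * p₂ g = q₁ g * q₂ g` is seen as a square with upper side `p₁ g`, right side
`p₂ g`, left side `q₁ g` and lower side `q₂ g`. This is the vertical composition of squares. -/
noncomputable def vert : ArrowGroupoid (Arr C) where
  r := P.p₁
  s := P.q₂
  mul x y := P.q₁ x * y
  inv x := (P.q₁ x)⁻¹ * P.p₁ x
  s_r x := by grind
  r_s x := by grind
  r_mul x y h := by
    rw [P.q₁_mul_eq h]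
    have := congrArg Arr.s h
    grind
  s_mul x y h := by
    have := congrArg Arr.r h
    grind
  assoc x y z h h' := by
    have := congrArg Arr.r h
    have := congrArg Arr.r h'
    rw [P.q₁_mul_left (P.q₁_mem x) (by grind), Arr.assoc (by grind) (by grind)]
  r_mul_self x := by grind
  mul_s_self x := by grind
  r_inv x := by rw [P.q₁_inv_mul_p₁]; grind
  s_inv x := by
    rw [P.q₂_mul_left (P.q₁_mem x).inv (by grind), P.q₂_of_mem_H (P.p₁_mem x)]
  inv_mul x := by
    rw [P.q₁_mul_left (P.q₁_mem x).inv (by grind), P.q₁_of_mem_H (P.p₁_mem x), P.r_p₁,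
      ← P.r_q₁, ← s_inv, mul_unit]
    conv_lhs => arg 2; rw [← P.q₁_mul_q₂ x]
    exact inv_mul_cancel_left (P.s_q₁ x)
  mul_inv x := by grind

/-- The vacant double groupoid of a matched pair. -/
noncomputable def squares : VacantDoubleGroupoid (Arr C) where
  V := P.vert
  H := P.swap.vert
  r_r x := by
    change P.p₁ (P.q₁ x) = P.q₁ (P.p₁ x)
    grind
  r_s x := by
    change P.p₁ (P.p₂ x) = P.p₂ (P.p₁ x)
    grind
  s_r x := by
    change P.q₂ (P.q₁ x) = P.q₁ (P.q₂ x)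
    grind
  s_s x := by
    change P.q₂ (P.p₂ x) = P.p₂ (P.q₂ x)
    grind
  r_mul x y h := by
    change P.q₂ x = P.p₁ y at h
    change P.q₁ (P.q₁ x * y) = P.q₁ (P.q₁ x) * P.q₁ y
    have := congrArg Arr.r h
    grind
  s_mul x y h := by
    change P.q₂ x = P.p₁ y at h
    change P.p₂ (P.q₁ x * y) = P.q₁ (P.p₂ x) * P.p₂ y
    rw [P.q₁_mul_eq h]
    have := congrArg Arr.s h
    grind
  r_mul' x y h := by
    change P.p₂ x = P.q₁ y at h
    change P.p₁ (P.p₁ x * y) = P.p₁ (P.p₁ x) * P.p₁ y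
    have := congrArg Arr.r h
    grind
  s_mul' x y h := by
    change P.p₂ x = P.q₁ y at h
    change P.q₂ (P.p₁ x * y) = P.p₁ (P.q₂ x) * P.q₂ y
    rw [show P.p₁ x * y = x * P.q₂ y from P.swap.q₁_mul_eq h]
    have := congrArg Arr.s h
    grind
  ext_rs x y h h' := by
    change P.q₁ x = P.q₁ y at h
    change P.q₂ x = P.q₂ y at h'
    rw [← P.q₁_mul_q₂ x, h, h', P.q₁_mul_q₂]
  ext_sr x y h h' := by
    change P.p₂ x = P.p₂ y at h
    change P.p₁ x = P.p₁ y at h'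
    rw [← P.p₁_mul_p₂ x, h, h', P.p₁_mul_p₂]
  fill_rs x y h := by
    change P.q₂ (P.q₁ x) = P.q₁ (P.q₂ y) at h
    have := congrArg Arr.r h
    refine ⟨P.q₁ x * P.q₂ y, ?_, ?_⟩
    · change P.q₁ (P.q₁ x * P.q₂ y) = P.q₁ x
      grind
    · change P.q₂ (P.q₁ x * P.q₂ y) = P.q₂ y
      grind
  fill_sr x y h := by
    change P.p₁ (P.p₂ x) = P.p₂ (P.p₁ y) at h
    have := congrArg Arr.r h
    refine ⟨P.p₁ y * P.p₂ x, ?_, ?_⟩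
    · change P.p₂ (P.p₁ y * P.p₂ x) = P.p₂ x
      grind
    · change P.p₁ (P.p₁ y * P.p₂ x) = P.p₁ y
      grind

end MatchPair

/-! ### Matrices of relations -/

section Relations

variable {ι κ μ : Type*}

open scoped Classical in
/-- The 0-1 matrix of a relation. -/
noncomputable def ofRel (R : ι → κ → Prop) : Matrix ι κ ℂ :=
  Matrix.of fun i j => if R i j then 1 else 0

open scoped Classical in
theorem ofRel_apply (R : ι → κ → Prop) (i : ι) (j : κ) : ofRel R i j = if R i j then 1 else 0 :=
  rfl

theorem ofRel_congr {R S : ι → κ → Prop} (h : ∀ i j, R i j ↔ S i j) : ofRel R = ofRel S := by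
  obtain rfl : R = S := by
    ext i j
    exact h i j
  rfl

/-- The matrix of the composite of a partial map with a relation. -/
theorem ofRel_mul [Fintype κ] {R : ι → κ → Prop} {S : κ → μ → Prop}
    (hR : ∀ i j j', R i j → R i j' → j = j') :
    ofRel R * ofRel S = ofRel fun i k => ∃ j, R i j ∧ S j k := by
  classical
  ext i k
  simp only [Matrix.mul_apply, ofRel_apply]
  by_cases h : ∃ j, R i j
  · obtain ⟨j, hj⟩ := h
    rw [Finset.sum_eq_single j]
    · have : (∃ j, R i j ∧ S j k) ↔ S j k :=
        ⟨fun ⟨j', h1, h2⟩ => hR i j j' hj h1 ▸ h2, fun h => ⟨j, hj, h⟩⟩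
      simp [hj, this]
    · intro j' _ hj'
      rw [if_neg fun h => hj' (hR i j' j h hj), zero_mul]
    · simp
  · rw [Finset.sum_eq_zero, if_neg]
    · rintro ⟨j, h1, _⟩
      exact h ⟨j, h1⟩
    · intro j _
      rw [if_neg fun h1 => h ⟨j, h1⟩, zero_mul]

theorem conjTranspose_ofRel (R : ι → κ → Prop) :
    (ofRel R).conjTranspose = ofRel fun j i => R i j := by
  ext j i
  simp only [Matrix.conjTranspose_apply, ofRel_apply]
  split_ifs <;> simp

theorem one_eq_ofRel [DecidableEq ι] : (1 : Matrix ι ι ℂ) = ofRel Eq := by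
  ext i j
  simp [Matrix.one_apply, ofRel_apply]

theorem kronecker_ofRel {ι' κ' : Type*} (R : ι → κ → Prop) (S : ι' → κ' → Prop) :
    ofRel R ⊗ₖ ofRel S = ofRel fun p q => R p.1 q.1 ∧ S p.2 q.2 := by
  ext p q
  simp only [Matrix.kroneckerMap_apply, ofRel_apply]
  by_cases h : R p.1 q.1 <;> by_cases h' : S p.2 q.2 <;> simp [h, h']

theorem sum_ofRel {γ : Type*} (s : Finset γ) {R : γ → ι → κ → Prop}
    (hR : ∀ i j, ∀ a ∈ s, ∀ b ∈ s, R a i j → R b i j → a = b) :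
    ∑ a ∈ s, ofRel (R a) = ofRel fun i j => ∃ a ∈ s, R a i j := by
  ext i j
  simp only [Matrix.sum_apply, ofRel_apply]
  by_cases h : ∃ a ∈ s, R a i j
  · rw [if_pos h]
    obtain ⟨a, ha, h⟩ := h
    rw [Finset.sum_eq_single_of_mem a ha, if_pos h]
    intro b hb hba
    exact if_neg fun h' => hba (hR i j b hb a ha h' h)
  · rw [if_neg h]
    exact Finset.sum_eq_zero fun a ha => if_neg fun h' => h ⟨a, ha, h'⟩

variable [DecidableEq ι]

theorem leg12_ofRel (R : ι × ι → ι × ι → Prop) :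
    leg12 (ofRel R) = ofRel fun p q => p.2.2 = q.2.2 ∧ R (p.1, p.2.1) (q.1, q.2.1) := by
  ext p q
  simp only [leg12, Matrix.of_apply, ofRel_apply]
  by_cases h : p.2.2 = q.2.2 <;> by_cases h' : R (p.1, p.2.1) (q.1, q.2.1) <;> simp [h, h']

theorem leg13_ofRel (R : ι × ι → ι × ι → Prop) :
    leg13 (ofRel R) = ofRel fun p q => p.2.1 = q.2.1 ∧ R (p.1, p.2.2) (q.1, q.2.2) := by
  ext p q
  simp only [leg13, Matrix.of_apply, ofRel_apply]
  by_cases h : p.2.1 = q.2.1 <;> by_cases h' : R (p.1, p.2.2) (q.1, q.2.2) <;> simp [h, h']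

theorem leg23_ofRel (R : ι × ι → ι × ι → Prop) :
    leg23 (ofRel R) = ofRel fun p q => p.1 = q.1 ∧ R p.2 q.2 := by
  ext p q
  simp only [leg23, Matrix.of_apply, ofRel_apply]
  by_cases h : p.1 = q.1 <;> by_cases h' : R p.2 q.2 <;> simp [h, h']

end Relations

/-! ### Regular representations -/

namespace ArrowGroupoid

variable {G : Type*} (V : ArrowGroupoid G)

/-- The left regular representation: `δ_y` is sent to `δ_{g y}`. -/
noncomputable def leftReg (g : G) : Matrix G G ℂ :=
  ofRel fun y y' => V.s g = V.r y' ∧ y = V.mul g y'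

/-- The right regular representation: `ξ` is sent to `x ↦ ξ (x g)`. -/
noncomputable def rightReg (g : G) : Matrix G G ℂ :=
  ofRel fun x x' => V.s x = V.r g ∧ x' = V.mul x g

theorem star_leftReg (g : G) : star (V.leftReg g) = V.leftReg (V.inv g) := by
  rw [Matrix.star_eq_conjTranspose, leftReg, conjTranspose_ofRel]
  refine ofRel_congr fun y y' => ⟨?_, ?_⟩
  · rintro ⟨h, rfl⟩; grind
  · rintro ⟨h, rfl⟩; grind

theorem star_rightReg (g : G) : star (V.rightReg g) = V.rightReg (V.inv g) := by
  rw [Matrix.star_eq_conjTranspose, rightReg, conjTranspose_ofRel]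
  refine ofRel_congr fun y y' => ⟨?_, ?_⟩
  · rintro ⟨h, rfl⟩; grind
  · rintro ⟨h, rfl⟩; grind

/-- A square is recovered from its left regular representation through the entries at units. -/
theorem leftReg_apply_s [DecidableEq G] (g g' : G) :
    V.leftReg g' g (V.s g) = if g' = g then 1 else 0 := by
  simp only [leftReg, ofRel_apply]
  congr 1
  grind

theorem rightReg_r_apply [DecidableEq G] (g g' : G) :
    V.rightReg g' (V.r g) g = if g' = g then 1 else 0 := by
  simp only [rightReg, ofRel_apply]
  congr 1
  grind

variable [Fintype G] [DecidableEq G]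

theorem leftReg_mul (x y : G) :
    V.leftReg x * V.leftReg y = if V.s x = V.r y then V.leftReg (V.mul x y) else 0 := by
  have h0 : V.leftReg x * V.leftReg y =
      ofRel fun z z' => ∃ w, (V.s x = V.r w ∧ z = V.mul x w) ∧ V.s y = V.r z' ∧ w = V.mul y z' :=
    ofRel_mul fun i j j' h h' => V.mul_left_cancel h.1 h'.1 (h.2.symm.trans h'.2)
  rw [h0]
  split_ifs with h
  · refine ofRel_congr fun z z' => ⟨?_, ?_⟩
    · rintro ⟨w, ⟨h1, rfl⟩, h2, rfl⟩; grind
    · rintro ⟨h1, rfl⟩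
      exact ⟨V.mul y z', by grind⟩
  · ext z z'
    rw [ofRel_apply, if_neg]
    · rfl
    · rintro ⟨w, ⟨h1, rfl⟩, h2, rfl⟩; grind

theorem rightReg_mul (x y : G) :
    V.rightReg x * V.rightReg y = if V.s x = V.r y then V.rightReg (V.mul x y) else 0 := by
  have h0 : V.rightReg x * V.rightReg y =
      ofRel fun z z' => ∃ w, (V.s z = V.r x ∧ w = V.mul z x) ∧ V.s w = V.r y ∧ z' = V.mul w y :=
    ofRel_mul fun i j j' h h' => h.2.trans h'.2.symm
  rw [h0]
  split_ifs with h
  · refine ofRel_congr fun z z' => ⟨?_, ?_⟩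
    · rintro ⟨w, ⟨h1, rfl⟩, h2, rfl⟩; grind
    · rintro ⟨h1, rfl⟩
      exact ⟨V.mul z x, by grind⟩
  · ext z z'
    rw [ofRel_apply, if_neg]
    · rfl
    · rintro ⟨w, ⟨h1, rfl⟩, h2, rfl⟩; grind

theorem leftReg_units : (1 : Matrix G G ℂ) = ∑ x, if V.r x = x then V.leftReg x else 0 := by
  rw [← Finset.sum_filter]
  simp only [leftReg]
  rw [sum_ofRel, one_eq_ofRel]
  · refine ofRel_congr fun y y' => ⟨?_, ?_⟩
    · rintro rfl
      exact ⟨V.r y, by simp [V.r_r], by grind⟩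
    · rintro ⟨x, hx, h1, h2⟩
      simp only [Finset.mem_filter, Finset.mem_univ, true_and] at hx
      grind
  · intro y y' a ha b hb h h'
    simp only [Finset.mem_filter, Finset.mem_univ, true_and] at ha hb
    grind

theorem rightReg_units : (1 : Matrix G G ℂ) = ∑ x, if V.r x = x then V.rightReg x else 0 := by
  rw [← Finset.sum_filter]
  simp only [rightReg]
  rw [sum_ofRel, one_eq_ofRel]
  · refine ofRel_congr fun y y' => ⟨?_, ?_⟩
    · rintro rfl
      exact ⟨V.s y, by simp [V.r_s], by grind⟩
    · rintro ⟨x, hx, h1, h2⟩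
      simp only [Finset.mem_filter, Finset.mem_univ, true_and] at hx
      grind
  · intro y y' a ha b hb h h'
    simp only [Finset.mem_filter, Finset.mem_univ, true_and] at ha hb
    grind

theorem leftReg_linearIndependent : LinearIndependent ℂ V.leftReg := by
  refine Fintype.linearIndependent_iff.2 fun c hc g => ?_
  have := congrFun (congrFun hc g) (V.s g)
  simpa [Matrix.sum_apply, leftReg_apply_s] using this

theorem rightReg_linearIndependent : LinearIndependent ℂ V.rightReg := by
  refine Fintype.linearIndependent_iff.2 fun c hc g => ?_
  have := congrFun (congrFun hc (V.r g)) g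
  simpa [Matrix.sum_apply, rightReg_r_apply] using this

end ArrowGroupoid

/-! ### The multiplicative partial isometry of a vacant double groupoid -/

namespace VacantDoubleGroupoid

variable {G : Type*} (D : VacantDoubleGroupoid G)

/-- The partial bijection of `G × G` underlying the multiplicative partial isometry: `(x, y)` is
related to `(x g, g⁻¹ y)`, the product being horizontal in the first component and vertical in the
second one. The square `g` is determined by its left and upper sides, which are the right side of
`x` and the upper side of `y`. -/
def IRel (p q : G × G) : Prop :=
  ∃ g, D.H.s p.1 = D.H.r g ∧ q.1 = D.H.mul p.1 g ∧ D.V.s g = D.V.r q.2 ∧ p.2 = D.V.mul g q.2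

/-- The operator `I` of a vacant double groupoid. -/
noncomputable def mpi : Matrix (G × G) (G × G) ℂ := ofRel D.IRel

theorem IRel.right_unique {p q q' : G × G} (h : D.IRel p q) (h' : D.IRel p q') : q = q' := by
  obtain ⟨x, y⟩ := p
  obtain ⟨x', y'⟩ := q
  obtain ⟨x'', y''⟩ := q'
  obtain ⟨g, h1, h2, h3, h4⟩ := h
  obtain ⟨g', k1, k2, k3, k4⟩ := h'
  simp only at *
  obtain rfl : g = g' := D.ext_rr (by rw [← h1, k1])
    (by rw [← D.V.r_mul g y' h3, ← h4, k4, D.V.r_mul g' y'' k3])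
  exact Prod.ext (h2.trans k2.symm) (D.V.mul_left_cancel h3 k3 (h4.symm.trans k4))

theorem IRel.left_unique {p p' q : G × G} (h : D.IRel p q) (h' : D.IRel p' q) : p = p' := by
  obtain ⟨x, y⟩ := p
  obtain ⟨x', y'⟩ := p'
  obtain ⟨x'', y''⟩ := q
  obtain ⟨g, h1, h2, h3, h4⟩ := h
  obtain ⟨g', k1, k2, k3, k4⟩ := h'
  simp only at *
  obtain rfl : g = g' := D.ext_ss
    (by rw [← D.H.s_mul x g h1, ← h2, k2, D.H.s_mul x' g' k1]) (by rw [h3, k3])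
  exact Prod.ext (D.H.mul_right_cancel h1 k1 (h2.symm.trans k2)) (h4.trans k4.symm)

variable [Fintype G]

/-- The final support of the partial isometry: a square with the right side of `p.1` as its left
side and the upper side of `p.2` as its upper side exists if and only if these sides meet. -/
theorem mpi_mul_conjTranspose : D.mpi * D.mpi.conjTranspose =
    ofRel fun p q => p = q ∧ D.V.r (D.H.s p.1) = D.H.r (D.V.r p.2) := by
  rw [mpi, conjTranspose_ofRel, ofRel_mul (R := D.IRel) fun i j j' h h' => IRel.right_unique D h h']
  refine ofRel_congr fun p q => ⟨?_, ?_⟩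
  · rintro ⟨w, h1, h2⟩
    refine ⟨IRel.left_unique D h1 h2, ?_⟩
    obtain ⟨g, k1, k2, k3, k4⟩ := h1
    rw [k1, k4, D.V.r_mul _ _ k3, D.r_r]
  · rintro ⟨rfl, h⟩
    obtain ⟨x, y⟩ := p
    obtain ⟨g, h1, h2⟩ := D.fill_rr (D.H.s x) y (by rw [D.H.r_s]; exact h)
    have : D.IRel (x, y) (D.H.mul x g, D.V.mul (D.V.inv g) y) :=
      ⟨g, by grind, rfl, by grind, (D.V.mul_inv_cancel_left h2).symm⟩
    exact ⟨_, this, this⟩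

/-- The initial support of the partial isometry: a square with the right side of `p.1` as its right
side and the upper side of `p.2` as its lower side exists if and only if these sides meet. -/
theorem conjTranspose_mul_mpi : D.mpi.conjTranspose * D.mpi =
    ofRel fun p q => p = q ∧ D.V.s (D.H.s p.1) = D.H.s (D.V.r p.2) := by
  rw [mpi, conjTranspose_ofRel,
    ofRel_mul (R := fun q p => D.IRel p q) fun i j j' h h' => IRel.left_unique D h h']
  refine ofRel_congr fun p q => ⟨?_, ?_⟩
  · rintro ⟨w, h1, h2⟩
    refine ⟨IRel.right_unique D h1 h2, ?_⟩
    obtain ⟨g, k1, k2, k3, k4⟩ := h1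
    rw [k2, D.H.s_mul _ _ k1, ← k3, D.s_s]
  · rintro ⟨rfl, h⟩
    obtain ⟨x, y⟩ := p
    obtain ⟨g, h1, h2⟩ := D.fill_ss x (D.V.r y) (by rw [D.V.s_r]; exact h)
    have : D.IRel (D.H.mul x (D.H.inv g), D.V.mul g y) (x, y) :=
      ⟨g, by grind, (D.H.inv_mul_cancel_right h1.symm).symm, by grind, rfl⟩
    exact ⟨_, this, this⟩

/-- The operator `I` is the canonical element of the pairing between the two regular
representations. -/
theorem mpi_eq_sum : D.mpi = ∑ g, D.H.rightReg g ⊗ₖ D.V.leftReg g := by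
  simp only [ArrowGroupoid.leftReg, ArrowGroupoid.rightReg, kronecker_ofRel]
  rw [sum_ofRel]
  · refine ofRel_congr fun p q => ⟨?_, ?_⟩
    · rintro ⟨g, h1, h2, h3, h4⟩
      exact ⟨g, Finset.mem_univ _, ⟨h1, h2⟩, h3, h4⟩
    · rintro ⟨g, _, ⟨h1, h2⟩, h3, h4⟩
      exact ⟨g, h1, h2, h3, h4⟩
  · rintro p q a _ b _ ⟨⟨h1, h2⟩, h3, h4⟩ ⟨⟨k1, k2⟩, k3, k4⟩
    exact D.H.mul_left_cancel h1 k1 (h2.symm.trans k2)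

variable [DecidableEq G]

/-- Both sides are 0-1 matrices of relations, which agree because a horizontal product `g g'` of two
squares that is also a vertical product is refined by `exists_factor`. -/
theorem pentagon : leg12 D.mpi * leg13 D.mpi * leg23 D.mpi = leg23 D.mpi * leg12 D.mpi := by
  have h12 : ∀ i j j' : G × G × G, (i.2.2 = j.2.2 ∧ D.IRel (i.1, i.2.1) (j.1, j.2.1)) →
      (i.2.2 = j'.2.2 ∧ D.IRel (i.1, i.2.1) (j'.1, j'.2.1)) → j = j' := by
    rintro i ⟨a, b, c⟩ ⟨a', b', c'⟩ ⟨e, h⟩ ⟨e', h'⟩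
    have := IRel.right_unique D h h'
    grind
  have h13 : ∀ i j j' : G × G × G, (i.2.1 = j.2.1 ∧ D.IRel (i.1, i.2.2) (j.1, j.2.2)) →
      (i.2.1 = j'.2.1 ∧ D.IRel (i.1, i.2.2) (j'.1, j'.2.2)) → j = j' := by
    rintro i ⟨a, b, c⟩ ⟨a', b', c'⟩ ⟨e, h⟩ ⟨e', h'⟩
    have := IRel.right_unique D h h'
    grind
  have h23 : ∀ i j j' : G × G × G, (i.1 = j.1 ∧ D.IRel i.2 j.2) →
      (i.1 = j'.1 ∧ D.IRel i.2 j'.2) → j = j' := by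
    rintro i ⟨a, b⟩ ⟨a', b'⟩ ⟨e, h⟩ ⟨e', h'⟩
    have := IRel.right_unique D h h'
    grind
  simp only [mpi, leg12_ofRel, leg13_ofRel, leg23_ofRel]
  rw [ofRel_mul h12, ofRel_mul h23, ofRel_mul]
  · refine ofRel_congr ?_
    rintro ⟨x, y, z⟩ ⟨x2, y2, z2⟩
    simp only [IRel, Prod.exists]
    constructor
    · rintro ⟨_, _, z1, ⟨x1, y1, _, ⟨rfl, g, h1, rfl, h3, rfl⟩, rfl, g', k1, rfl, k3, rfl⟩, rfl,
        g'', l1, rfl, l3, rfl⟩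
      have e1 : D.H.s g = D.H.r g' := by rw [← k1, D.H.s_mul _ _ h1]
      have e2 : D.V.s g' = D.V.r g'' := by rw [k3, D.V.r_mul _ _ l3]
      refine ⟨x, D.H.mul (D.V.mul g y1) (D.V.mul g' g''), z2,
        ⟨rfl, D.V.mul g' g'', ?_, rfl, ?_, ?_⟩, rfl, D.H.mul g g', ?_, ?_, ?_, ?_⟩
      · rw [D.s_mul _ _ h3, l1, e1, D.r_mul _ _ e2]
      · grind
      · grind
      · grind
      · grind
      · rw [D.s_mul' _ _ e1, h3, e2, D.r_mul' _ _ l1]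
      · exact (D.interchange e1 l1 h3 e2).symm
    · rintro ⟨_, y', _, ⟨rfl, h, h1, rfl, h3, rfl⟩, e, k, k1, rfl, k3, k4⟩
      subst e
      obtain ⟨g, g', y1, g'', a1, a2, a3, a4, rfl, rfl, rfl, rfl⟩ := D.exists_factor h1 k3 k4
      refine ⟨D.H.mul x (D.H.mul g g'), y1, D.V.mul g'' _, ⟨D.H.mul x g, y1, _,
        ⟨rfl, g, ?_, rfl, a3, rfl⟩, rfl, g', ?_, ?_, ?_, ?_⟩, rfl, g'', a2, rfl, ?_, rfl⟩
      · grind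
      · grind
      · grind
      · grind
      · grind
      · grind
  · rintro i j j' ⟨a, h1, h2⟩ ⟨a', h1', h2'⟩
    obtain rfl := h12 _ _ _ h1 h1'
    exact h13 _ _ _ h2 h2'

/-- The coproduct of the left regular representation is implemented by the partial isometry. -/
theorem mpi_leftReg (z : G) :
    D.mpi * (D.V.leftReg z ⊗ₖ (1 : Matrix G G ℂ)) * D.mpi.conjTranspose =
      ∑ p ∈ D.factorizations z, D.V.leftReg p.1 ⊗ₖ D.V.leftReg p.2 := by
  simp only [mpi, ArrowGroupoid.leftReg, one_eq_ofRel, kronecker_ofRel, conjTranspose_ofRel]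
  rw [ofRel_mul (R := D.IRel) fun i j j' h h' => IRel.right_unique D h h', ofRel_mul, sum_ofRel]
  · refine ofRel_congr ?_
    rintro ⟨x, y⟩ ⟨x', y'⟩
    simp only [IRel, Prod.exists, mem_factorizations]
    constructor
    · rintro ⟨u, w, ⟨_, _, ⟨g, h1, rfl, h3, rfl⟩, ⟨h5, h6⟩, rfl⟩, g', k1, rfl, k3, rfl⟩
      obtain ⟨a, b, c, d, a1, a2, a3, a4, rfl, a6, rfl, rfl⟩ := D.exists_factor h1 h5 h6
      obtain rfl : d = g' := D.ext_ss
        (by rw [← D.H.s_mul c d a2, a6, D.H.s_mul x' g' k1])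
        (by rw [k3, ← h3, D.V.s_mul b d a4])
      obtain rfl : c = x' := D.H.mul_right_cancel a2 k1 a6
      exact ⟨a, b, ⟨a1, rfl⟩, ⟨a3, rfl⟩, by grind, by grind⟩
    · rintro ⟨a, b, ⟨h1, rfl⟩, ⟨h3, rfl⟩, h5, rfl⟩
      obtain ⟨g', k1, k2⟩ := D.fill_rr (D.H.s x') (D.V.s b)
        (by rw [D.H.r_s, D.V.r_s, ← D.s_r, ← h1, D.s_s, h3, D.r_s])
      have k3 : D.H.s x' = D.H.r g' := by rw [k1, D.H.r_s]
      have k4 : D.V.s b = D.V.r g' := by rw [k2, D.V.r_s]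
      refine ⟨D.H.mul x' g', D.V.mul (D.V.inv g') y', ⟨_, _, ⟨D.V.mul b g', ?_, rfl, ?_, ?_⟩,
        ⟨?_, ?_⟩, rfl⟩, g', k3, rfl, ?_, ?_⟩
      · rw [D.s_mul _ _ h3, h1, k3, D.r_mul _ _ k4]
      · grind
      · grind
      · rw [D.s_mul' _ _ h1, h3, k4, D.r_mul' _ _ k3]
      · exact (D.interchange h1 k3 h3 k4).symm
      · grind
      · grind
  · rintro ⟨x, y⟩ ⟨x', y'⟩ ⟨a, b⟩ _ ⟨a', b'⟩ _ ⟨⟨h1, h2⟩, h3, h4⟩ ⟨⟨k1, k2⟩, k3, k4⟩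
    exact Prod.ext (D.V.mul_right_cancel h1 k1 (h2.symm.trans k2))
      (D.V.mul_right_cancel h3 k3 (h4.symm.trans k4))
  · rintro i j j' ⟨w, h1, ⟨h2, h3⟩, h4⟩ ⟨w', k1, ⟨k2, k3⟩, k4⟩
    obtain rfl := IRel.right_unique D h1 k1
    exact Prod.ext (D.V.mul_left_cancel h2 k2 (h3.symm.trans k3)) (h4.symm.trans k4)

/-- The coproduct of the right regular representation is implemented by the adjoint of the partial
isometry. -/
theorem mpi_rightReg (z : G) :
    D.mpi.conjTranspose * ((1 : Matrix G G ℂ) ⊗ₖ D.H.rightReg z) * D.mpi =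
      ∑ p ∈ D.swap.factorizations z, D.H.rightReg p.1 ⊗ₖ D.H.rightReg p.2 := by
  simp only [mpi, ArrowGroupoid.rightReg, one_eq_ofRel, kronecker_ofRel, conjTranspose_ofRel]
  rw [ofRel_mul (R := fun q p => D.IRel p q) fun i j j' h h' => IRel.left_unique D h h',
    ofRel_mul, sum_ofRel]
  · refine ofRel_congr ?_
    rintro ⟨x', y'⟩ ⟨x'', y''⟩
    simp only [IRel, Prod.exists, mem_factorizations]
    change _ ↔ ∃ a b, (D.V.s a = D.V.r b ∧ D.V.mul a b = z) ∧ _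
    constructor
    · rintro ⟨_, _, ⟨x, _, ⟨g, h1, rfl, h3, rfl⟩, rfl, h5, rfl⟩, g'', k1, rfl, k3, k4⟩
      obtain ⟨a, b, c, d, a1, a2, a3, a4, rfl, rfl, a6, rfl⟩ := D.exists_factor h5 k3 k4
      obtain rfl : a = g := D.ext_rr
        (by rw [← D.H.r_mul a b a1, ← k1, h1])
        (by rw [← D.V.r_mul a c a3, a6, D.V.r_mul g y' h3])
      obtain rfl : c = y' := D.V.mul_left_cancel a3 h3 a6
      exact ⟨b, d, ⟨a4, rfl⟩, ⟨by grind, by grind⟩, a2, rfl⟩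
    · rintro ⟨a, b, ⟨h1, rfl⟩, ⟨h3, rfl⟩, h5, rfl⟩
      obtain ⟨g, k1, k2⟩ := D.fill_ss (D.H.r a) (D.V.r y')
        (by rw [D.H.s_r, D.V.s_r, D.s_r, h1, ← D.r_r, ← h5, D.r_s])
      have k3 : D.H.s g = D.H.r a := by rw [k1, D.H.s_r]
      have k4 : D.V.s g = D.V.r y' := by rw [k2, D.V.s_r]
      refine ⟨D.H.mul x' (D.H.inv g), _, ⟨D.H.mul x' (D.H.inv g), D.V.mul g y',
        ⟨g, ?_, ?_, k4, rfl⟩, rfl, ?_, rfl⟩, D.H.mul g a, ?_, ?_, ?_, ?_⟩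
      · grind
      · grind
      · rw [D.s_mul _ _ k4, k3, h5, D.r_mul _ _ h1]
      · grind
      · grind
      · rw [D.s_mul' _ _ k3, k4, h1, D.r_mul' _ _ h5]
      · exact (D.interchange k3 h5 k4 h1).symm
  · rintro ⟨x, y⟩ ⟨x', y'⟩ ⟨a, b⟩ _ ⟨a', b'⟩ _ ⟨⟨h1, h2⟩, h3, h4⟩ ⟨⟨k1, k2⟩, k3, k4⟩
    exact Prod.ext (D.H.mul_left_cancel h1 k1 (h2.symm.trans k2))
      (D.H.mul_left_cancel h3 k3 (h4.symm.trans k4))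
  · rintro i j j' ⟨w, h1, h2, h3, h4⟩ ⟨w', k1, k2, k3, k4⟩
    obtain rfl := IRel.left_unique D h1 k1
    exact Prod.ext (h2.symm.trans k2) (h4.trans k4.symm)

end VacantDoubleGroupoid

/-! ### The structures induced by the partial isometry -/

section Slices

variable {ι γ : Type*}

/-- Linear forms separate the values of a linearly independent family. -/
theorem exists_linearForm {M : γ → Matrix ι ι ℂ} (hM : LinearIndependent ℂ M) (c : γ → ℂ) :
    ∃ ω : Matrix ι ι ℂ →ₗ[ℂ] ℂ, ∀ g, ω (M g) = c g := by
  obtain ⟨ω, hω⟩ := ((Module.Basis.span hM).constr ℂ c).exists_extend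
  refine ⟨ω, fun g => ?_⟩
  have h := (Module.Basis.span hM).constr_basis ℂ c g
  rw [← hω] at h
  simpa [Module.Basis.span_apply] using h

variable [Fintype γ]

theorem sliceL_sum_kronecker (ω : Matrix ι ι ℂ →ₗ[ℂ] ℂ) (M N : γ → Matrix ι ι ℂ) :
    sliceL ω (∑ g, M g ⊗ₖ N g) = ∑ g, ω (M g) • N g := by
  ext y y'
  have : (Matrix.of fun x x' => (∑ g, M g ⊗ₖ N g) (x, y) (x', y')) = ∑ g, N g y y' • M g := by
    ext x x'
    simp [Matrix.sum_apply, mul_comm]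
  simp only [sliceL, Matrix.of_apply, this]
  simp [Matrix.sum_apply, mul_comm]

theorem sliceR_sum_kronecker (ω : Matrix ι ι ℂ →ₗ[ℂ] ℂ) (M N : γ → Matrix ι ι ℂ) :
    sliceR ω (∑ g, M g ⊗ₖ N g) = ∑ g, ω (N g) • M g := by
  ext y y'
  have : (Matrix.of fun x x' => (∑ g, M g ⊗ₖ N g) (y, x) (y', x')) = ∑ g, M g y y' • N g := by
    ext x x'
    simp [Matrix.sum_apply]
  simp only [sliceR, Matrix.of_apply, this]
  simp [Matrix.sum_apply, mul_comm]

theorem legS_sum_kronecker {M N : γ → Matrix ι ι ℂ} (hM : LinearIndependent ℂ M) :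
    legS (∑ g, M g ⊗ₖ N g) = Submodule.span ℂ (Set.range N) := by
  ext x
  rw [SetLike.mem_coe, Submodule.mem_span_range_iff_exists_fun]
  constructor
  · rintro ⟨ω, rfl⟩
    exact ⟨_, (sliceL_sum_kronecker ω M N).symm⟩
  · rintro ⟨c, rfl⟩
    obtain ⟨ω, hω⟩ := exists_linearForm hM c
    refine ⟨ω, ?_⟩
    simp only [sliceL_sum_kronecker, hω]

theorem legShat_sum_kronecker {M N : γ → Matrix ι ι ℂ} (hN : LinearIndependent ℂ N) :
    legShat (∑ g, M g ⊗ₖ N g) = Submodule.span ℂ (Set.range M) := by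
  ext x
  rw [SetLike.mem_coe, Submodule.mem_span_range_iff_exists_fun]
  constructor
  · rintro ⟨ω, rfl⟩
    exact ⟨_, (sliceR_sum_kronecker ω M N).symm⟩
  · rintro ⟨c, rfl⟩
    obtain ⟨ω, hω⟩ := exists_linearForm hN c
    refine ⟨ω, ?_⟩
    simp only [sliceR_sum_kronecker, hω]

theorem tensorSq_tmul {A : Type*} [Ring A] [Algebra ℂ A] (Φ : A →ₗ[ℂ] Matrix ι ι ℂ) (a b : A) :
    tensorSq Φ (a ⊗ₜ[ℂ] b) = Φ a ⊗ₖ Φ b := by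
  rfl

end Slices

namespace VacantDoubleGroupoid

variable {G : Type*} [Fintype G]

theorem injective_of_linearIndependent [DecidableEq G] {A : Type*} [Ring A] [StarRing A]
    [Algebra ℂ A] {e : Module.Basis G ℂ A} {Φ : A →⋆ₐ[ℂ] Matrix G G ℂ}
    (h : LinearIndependent ℂ fun g => Φ (e g)) :
    Function.Injective Φ := by
  rw [injective_iff_map_eq_zero]
  intro a ha
  rw [← e.sum_repr a, map_sum] at ha
  simp only [map_smul] at ha
  have := Fintype.linearIndependent_iff.1 h _ ha
  rw [← e.sum_repr a]
  simp [this]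

variable {D : VacantDoubleGroupoid G}

/-- The adjoint of `I`, with the inversion on the second leg. -/
theorem conjTranspose_mpi :
    D.mpi.conjTranspose = ∑ g, D.H.rightReg g ⊗ₖ D.V.leftReg (D.inv g) := by
  rw [mpi_eq_sum, Matrix.conjTranspose_sum]
  have h (g : G) : (D.H.rightReg g ⊗ₖ D.V.leftReg g).conjTranspose =
      D.H.rightReg (D.H.inv g) ⊗ₖ D.V.leftReg (D.V.inv g) := by
    rw [Matrix.conjTranspose_kronecker, ← D.H.star_rightReg, ← D.V.star_leftReg]
    rfl
  simp only [h]
  refine Finset.sum_nbij' D.H.inv D.H.inv (by simp) (by simp) ?_ ?_ ?_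
  · simp [D.H.inv_inv]
  · simp [D.H.inv_inv]
  · simp [inv, D.H.inv_inv]

/-- The adjoint of `I`, with the inversion on the first leg. -/
theorem conjTranspose_mpi' :
    D.mpi.conjTranspose = ∑ g, D.H.rightReg (D.inv g) ⊗ₖ D.V.leftReg g := by
  rw [conjTranspose_mpi]
  refine Finset.sum_nbij' D.inv D.inv (by simp) (by simp) ?_ ?_ ?_ <;> simp [D.inv_inv]

variable [DecidableEq G]

theorem legS_mpi : legS D.mpi = Submodule.span ℂ (Set.range D.V.leftReg) := by
  rw [mpi_eq_sum, legS_sum_kronecker D.H.rightReg_linearIndependent]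

theorem legShat_mpi : legShat D.mpi = Submodule.span ℂ (Set.range D.H.rightReg) := by
  rw [mpi_eq_sum, legShat_sum_kronecker D.V.leftReg_linearIndependent]

variable {A : Type*} [Ring A] [StarRing A] [Algebra ℂ A] {e : Module.Basis G ℂ A}
  {Φ : A →⋆ₐ[ℂ] Matrix G G ℂ}

theorem isConvolutionBasis_leftReg (hΦ : ∀ g, Φ (e g) = D.V.leftReg g) :
    Function.Injective Φ ∧ D.IsConvolutionBasis e := by
  have hinj : Function.Injective Φ :=
    injective_of_linearIndependent (e := e) (by simpa only [hΦ] using D.V.leftReg_linearIndependent)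
  refine ⟨hinj, fun x y => hinj ?_, fun x => hinj ?_, hinj ?_⟩
  · rw [map_mul, apply_ite Φ, hΦ, hΦ, hΦ, map_zero, D.V.leftReg_mul]
  · rw [map_star, hΦ, hΦ, D.V.star_leftReg]
  · simp only [map_one, map_sum, apply_ite Φ, hΦ, map_zero]
    exact D.V.leftReg_units

theorem isConvolutionBasis_rightReg (hΦ : ∀ g, Φ (e g) = D.H.rightReg g) :
    Function.Injective Φ ∧ D.swap.IsConvolutionBasis e := by
  have hinj : Function.Injective Φ :=
    injective_of_linearIndependent (e := e)
      (by simpa only [hΦ] using D.H.rightReg_linearIndependent)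
  refine ⟨hinj, fun x y => hinj ?_, fun x => hinj ?_, hinj ?_⟩
  · rw [map_mul, apply_ite Φ, hΦ, hΦ, hΦ, map_zero, D.H.rightReg_mul]
    rfl
  · rw [map_star, hΦ, hΦ, D.H.star_rightReg]
    rfl
  · simp only [map_one, map_sum, apply_ite Φ, hΦ, map_zero]
    exact D.H.rightReg_units

theorem eq_sum_of_sliceL (hΦ : ∀ g, Φ (e g) = D.V.leftReg g) {ω : Matrix G G ℂ →ₗ[ℂ] ℂ} {a : A}
    (h : Φ a = sliceL ω D.mpi) : a = ∑ g, ω (D.H.rightReg g) • e g := by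
  apply (isConvolutionBasis_leftReg hΦ).1
  rw [h, mpi_eq_sum, sliceL_sum_kronecker]
  simp only [map_sum, map_smul, hΦ]

theorem eq_sum_of_sliceR (hΦ : ∀ g, Φ (e g) = D.H.rightReg g) {ω : Matrix G G ℂ →ₗ[ℂ] ℂ} {a : A}
    (h : Φ a = sliceR ω D.mpi) : a = ∑ g, ω (D.V.leftReg g) • e g := by
  apply (isConvolutionBasis_rightReg hΦ).1
  rw [h, mpi_eq_sum, sliceR_sum_kronecker]
  simp only [map_sum, map_smul, hΦ]

theorem isInducedBracket {B : Type*} [Ring B] [StarRing B] [Algebra ℂ B] {f : Module.Basis G ℂ B}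
    {Ψ : B →⋆ₐ[ℂ] Matrix G G ℂ} (hΦ : ∀ g, Φ (e g) = D.V.leftReg g)
    (hΨ : ∀ g, Ψ (f g) = D.H.rightReg g) :
    IsInducedBracket D.mpi Φ Ψ (bracket e f) := by
  intro ω ω' a x ha hx
  rw [eq_sum_of_sliceL hΦ ha, eq_sum_of_sliceR hΨ hx, mpi_eq_sum, sliceL_sum_kronecker]
  simp only [map_sum, map_smul, LinearMap.sum_apply, LinearMap.smul_apply, bracket_basis]
  simp [mul_comm]

variable [StarModule ℂ A]

theorem isInducedOnS (hΦ : ∀ g, Φ (e g) = D.V.leftReg g) (he : D.IsConvolutionBasis e)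
    (hA : ∃ (n : ℕ) (π : A →⋆ₐ[ℂ] Matrix (Fin n) (Fin n) ℂ), Function.Injective π) :
    IsInducedOnS D.mpi Φ (weakHopf he hA) where
  comul a := by
    change tensorSq Φ.toAlgHom.toLinearMap (D.comul e a) = _
    induction a using basis_induction e with
    | zero => simp
    | add x y hx hy => simp only [map_add, hx, hy, Matrix.add_kronecker, mul_add, add_mul]
    | smul c x hx => simp only [map_smul, hx, Matrix.smul_kronecker, mul_smul_comm, smul_mul_assoc]
    | basis g =>
    rw [hΦ, mpi_leftReg, comul_basis, map_sum]
    refine Finset.sum_congr rfl fun p _ => ?_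
    rw [tensorSq_tmul, ← hΦ, ← hΦ]
    rfl
  antipode ω a h := by
    change Φ (D.antipode e a) = _
    rw [eq_sum_of_sliceL hΦ h, conjTranspose_mpi, sliceL_sum_kronecker]
    simp only [map_sum, map_smul, antipode_basis, hΦ]
  counit ω a h := by
    change D.counit e a = _
    rw [eq_sum_of_sliceL hΦ h, D.H.rightReg_units]
    simp only [map_sum, map_smul, counit_basis, smul_eq_mul, mul_ite, mul_one, mul_zero,
      apply_ite ω, map_zero]

theorem isInducedOnShat (hΦ : ∀ g, Φ (e g) = D.H.rightReg g) (he : D.swap.IsConvolutionBasis e)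
    (hA : ∃ (n : ℕ) (π : A →⋆ₐ[ℂ] Matrix (Fin n) (Fin n) ℂ), Function.Injective π) :
    IsInducedOnShat D.mpi Φ (weakHopf he hA) where
  comul a := by
    change tensorSq Φ.toAlgHom.toLinearMap (D.swap.comul e a) = _
    induction a using basis_induction e with
    | zero => simp
    | add x y hx hy => simp only [map_add, hx, hy, Matrix.kronecker_add, mul_add, add_mul]
    | smul c x hx => simp only [map_smul, hx, Matrix.kronecker_smul, mul_smul_comm, smul_mul_assoc]
    | basis g =>
    rw [hΦ, mpi_rightReg, comul_basis, map_sum]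
    refine Finset.sum_congr rfl fun p _ => ?_
    rw [tensorSq_tmul, ← hΦ, ← hΦ]
    rfl
  antipode ω a h := by
    change Φ (D.swap.antipode e a) = _
    have hinv : ∀ g, D.swap.inv g = D.inv g := fun g => (D.inv_comm g).symm
    rw [eq_sum_of_sliceR hΦ h, conjTranspose_mpi', sliceR_sum_kronecker]
    simp only [map_sum, map_smul, antipode_basis, hΦ, hinv]
  counit ω a h := by
    change D.swap.counit e a = _
    rw [eq_sum_of_sliceR hΦ h, D.V.leftReg_units]
    simp only [map_sum, map_smul, counit_basis, smul_eq_mul, mul_ite, mul_one, mul_zero,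
      apply_ite ω, map_zero]
    rfl

end VacantDoubleGroupoid

/-! ### Regularity -/

namespace VacantDoubleGroupoid

variable {G : Type*} [Fintype G] [DecidableEq G] (D : VacantDoubleGroupoid G)

theorem sliceR_flip_mpi (ω : Matrix G G ℂ →ₗ[ℂ] ℂ) (x x' : G) :
    sliceR ω (flipOp * D.mpi) x x' = ω (ofRel fun y y' => D.IRel (y, x) (x', y')) := by
  have hflip : (flipOp : Matrix (G × G) (G × G) ℂ) = ofRel fun p q => p.1 = q.2 ∧ p.2 = q.1 := by
    ext p q
    simp [flipOp, ofRel_apply]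
  have h : flipOp * D.mpi = ofRel fun p q : G × G => D.IRel (p.2, p.1) q := by
    rw [hflip, mpi, ofRel_mul]
    · refine ofRel_congr fun p q => ⟨?_, fun h => ⟨_, ⟨rfl, rfl⟩, h⟩⟩
      rintro ⟨⟨a, b⟩, ⟨rfl, rfl⟩, h⟩
      exact h
    · rintro p ⟨a, b⟩ ⟨a', b'⟩ ⟨rfl, rfl⟩ ⟨rfl, rfl⟩
      rfl
  rw [h]
  rfl

/-- The slices of `Σ I` are all the operators whose nonzero matrix entries are at positions
`(x, x')` for which the upper right corners of the squares `x` and `x'` agree. For such `x` and `x'`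
there is exactly one square `g` with the right side of `x'` and the upper side of `x`, so that the
block of `Σ I` in position `(x, x')` is a matrix unit; these blocks are linearly independent. -/
theorem range_sliceR_flip_mpi :
    (Set.range fun ω : Matrix G G ℂ →ₗ[ℂ] ℂ => sliceR ω (flipOp * D.mpi)) =
      {M | ∀ x x', D.V.r (D.H.s x') ≠ D.H.s (D.V.r x) → M x x' = 0} := by
  have hne : ∀ {x x' y y'}, D.IRel (y, x) (x', y') → D.V.r (D.H.s x') = D.H.s (D.V.r x) := by
    rintro x x' y y' ⟨g, h1, h2, h3, h4⟩
    simp only at h1 h2 h3 h4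
    rw [h2, h4, D.H.s_mul _ _ h1, D.V.r_mul _ _ h3, D.r_s]
  ext M
  constructor
  · rintro ⟨ω, rfl⟩ x x' h
    simp only [sliceR_flip_mpi]
    rw [← map_zero ω]
    congr 1
    ext y y'
    exact if_neg fun h' => h (hne h')
  · intro hM
    let N : {p : G × G // D.V.r (D.H.s p.2) = D.H.s (D.V.r p.1)} → Matrix G G ℂ :=
      fun p => ofRel fun y y' => D.IRel (y, p.1.1) (p.1.2, y')
    have hN : LinearIndependent ℂ N := by
      refine Fintype.linearIndependent_iff.2 fun c hc => ?_
      rintro ⟨⟨x, x'⟩, h⟩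
      -- the block in position `(x, x')` is the only one with a nonzero entry in this place
      obtain ⟨g, h1, h2⟩ := D.fill_sr x' x h
      have hy : D.IRel (D.H.mul x' (D.H.inv g), x) (x', D.V.mul (D.V.inv g) x) :=
        ⟨g, by grind, (D.H.inv_mul_cancel_right h1.symm).symm, by grind,
          (D.V.mul_inv_cancel_left h2).symm⟩
      have := congrFun (congrFun hc (D.H.mul x' (D.H.inv g))) (D.V.mul (D.V.inv g) x)
      rw [Matrix.sum_apply, Finset.sum_eq_single ⟨(x, x'), h⟩] at this
      · simpa [N, ofRel_apply, hy] using this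
      · rintro ⟨⟨a, a'⟩, ha⟩ _ hne'
        have : ¬ D.IRel (D.H.mul x' (D.H.inv g), a) (a', D.V.mul (D.V.inv g) x) := by
          intro hy'
          apply hne'
          obtain ⟨k, h1, h2, h3, h4⟩ := hy
          obtain ⟨k', l1, l2, l3, l4⟩ := hy'
          simp only at h1 h2 h3 h4 l1 l2 l3 l4
          obtain rfl : k = k' := D.ext_rs _ _ (h1.symm.trans l1) (h3.trans l3.symm)
          ext
          · exact l4.trans h4.symm
          · exact l2.trans h2.symm
        simp [N, ofRel_apply, this]
      · simp
    obtain ⟨ω, hω⟩ := exists_linearForm hN fun p => M p.1.1 p.1.2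
    refine ⟨ω, ?_⟩
    ext x x'
    simp only [sliceR_flip_mpi]
    by_cases h : D.V.r (D.H.s x') = D.H.s (D.V.r x)
    · exact hω ⟨(x, x'), h⟩
    · rw [hM x x' h, ← map_zero ω]
      congr 1
      ext y y'
      exact if_neg fun h' => h (hne h')

end VacantDoubleGroupoid

namespace MatchPair

open Arr

variable {C : Type u} [Groupoid.{v} C] (P : MatchPair C)

/-! ### The partial isometry of a matched pair -/

/-- The relation of the double groupoid of squares is the partial bijection defining `P.I`: the
square `g` is `p₂ x * p₁ ((p₂ x)⁻¹ * y)`. -/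
theorem squares_IRel (p q : Arr C × Arr C) :
    P.squares.IRel p q ↔ P.m p.1 = p.2.r ∧
      q = (p.1 * P.p₁ ((P.p₂ p.1)⁻¹ * p.2), (P.p₂ p.1)⁻¹ * p.2) := by
  obtain ⟨x, y⟩ := p
  obtain ⟨x', y'⟩ := q
  change (∃ g, P.p₂ x = P.q₁ g ∧ x' = P.p₁ x * g ∧ P.q₂ g = P.p₁ y' ∧ y = P.q₁ g * y') ↔ _
  simp only [m, P.s_p₁, Prod.mk.injEq]
  constructor
  · rintro ⟨g, h1, rfl, h3, rfl⟩
    have h4 : (P.q₁ g).s = y'.r := by rw [P.s_q₁, h3, P.r_p₁]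
    have h5 : (P.p₂ x).s = (P.p₁ y').r := by rw [h1, h4, P.r_p₁]
    rw [h1, Arr.inv_mul_cancel_left h4]
    refine ⟨(Arr.r_mul h4).symm, ?_, rfl⟩
    conv_lhs => rw [← P.q₁_mul_q₂ g, ← h1, h3]
    rw [← Arr.assoc (P.s_p₁ x) h5, P.p₁_mul_p₂]
  · rintro ⟨h1, rfl, rfl⟩
    have h2 : (P.p₂ x).s = (P.p₁ ((P.p₂ x)⁻¹ * y)).r := by grind
    refine ⟨P.p₂ x * P.p₁ ((P.p₂ x)⁻¹ * y), ?_, ?_, ?_, ?_⟩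
    · grind
    · rw [← Arr.assoc (P.s_p₁ x) h2, P.p₁_mul_p₂]
    · grind
    · rw [P.q₁_mul_right (P.p₁_mem _) h2, P.q₁_of_mem_K (P.p₂_mem x),
        Arr.mul_inv_cancel_left h1]

theorem I_eq_mpi : P.I = P.squares.mpi := by
  ext p q
  classical
  exact if_congr (P.squares_IRel p q).symm rfl rfl

theorem Vr_Hs (x : Arr C) : P.squares.V.r (P.squares.H.s x) = unit (P.m x) := by
  change P.p₁ (P.p₂ x) = _
  rw [P.p₁_of_mem_K (P.p₂_mem x), ← P.s_p₁]
  rfl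

theorem Hs_Vr (x : Arr C) : P.squares.H.s (P.squares.V.r x) = unit (P.m x) := by
  change P.p₂ (P.p₁ x) = _
  rw [P.p₂_of_mem_H (P.p₁_mem x)]
  rfl

theorem Hr_Vr (x : Arr C) : P.squares.H.r (P.squares.V.r x) = unit x.r := by
  change P.q₁ (P.p₁ x) = _
  rw [P.q₁_of_mem_H (P.p₁_mem x), P.r_p₁]

theorem Vs_Hs (x : Arr C) : P.squares.V.s (P.squares.H.s x) = unit x.s := by
  change P.q₂ (P.p₂ x) = _
  rw [P.q₂_of_mem_K (P.p₂_mem x), P.s_p₂]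

theorem unit_inj {a b : C} : unit a = unit b ↔ a = b :=
  ⟨fun h => congrArg Arr.r h, fun h => congrArg unit h⟩

theorem m_unit (a : C) : P.m (unit a) = a := by
  rw [m, P.p₁_of_mem_H (P.unit_mem_H a)]
  rfl

/-- The corners of the squares `p`, `q` related by `I`. -/
theorem corners_of_IRel {p q : Arr C × Arr C} (h : P.squares.IRel p q) :
    q.1.r = p.1.r ∧ q.2.s = p.2.s ∧ P.m q.1 = P.m p.2 ∧ q.2.r = p.1.s := by
  obtain ⟨x, y⟩ := p
  obtain ⟨x', y'⟩ := q
  obtain ⟨g, h1, h2, h3, h4⟩ := h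
  simp only at h1 h2 h3 h4 ⊢
  refine ⟨?_, ?_, ?_, ?_⟩ <;> rw [← unit_inj]
  · rw [← Hr_Vr, ← Hr_Vr, h2, P.squares.r_mul' _ _ h1, P.squares.H.r_mul]
    rw [← P.squares.r_s, h1, P.squares.r_r]
  · rw [← Vs_Hs, ← Vs_Hs, h4, P.squares.s_mul _ _ h3, P.squares.V.s_mul]
    rw [P.squares.s_s, h3, P.squares.r_s]
  · rw [← Vr_Hs, ← Hs_Vr, h2, h4, P.squares.H.s_mul _ _ h1, P.squares.V.r_mul _ _ h3,
      P.squares.r_s]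
  · rw [← Hr_Vr, ← Vs_Hs, h1, ← h3, P.squares.s_r]

section Finite

variable [Finite C] [∀ a b : C, Finite (a ⟶ b)]

theorem baseRep_apply (q : Arr C → C) (f : C → ℂ) :
    baseRep q f = Matrix.diagonal fun g => f (q g) := rfl

theorem baseRep_injective {q : Arr C → C} (hq : Function.Surjective q) :
    Function.Injective (baseRep q) := by
  intro f f' h
  ext a
  obtain ⟨g, rfl⟩ := hq a
  exact congrFun (Matrix.diagonal_injective h) g

theorem baseRep_commute (q q' : Arr C → C) (f f' : C → ℂ) :
    Commute (baseRep q f) (baseRep q' f') := by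
  simp only [Commute, SemiconjBy, baseRep_apply, Matrix.diagonal_mul_diagonal, mul_comm]

theorem baseRep_kronecker_baseRep (q q' : Arr C → C) (f f' : C → ℂ) :
    baseRep q f ⊗ₖ baseRep q' f' = Matrix.diagonal fun x => f (q x.1) * f' (q' x.2) :=
  Matrix.diagonal_kronecker_diagonal _ _

theorem isRegularMPI : IsRegularMPI P.I P.α := by
  rw [IsRegularMPI, I_eq_mpi, P.squares.range_sliceR_flip_mpi]
  ext M
  simp only [Vr_Hs, Hs_Vr, ne_eq, unit_inj, Set.mem_centralizer_iff, Set.forall_mem_range, α,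
    baseRep_apply]
  constructor
  · intro h n
    ext x x'
    rw [Matrix.mul_diagonal, Matrix.diagonal_mul]
    by_cases hx : P.m x' = P.m x
    · rw [hx, mul_comm]
    · rw [h x x' hx, zero_mul, mul_zero]
  · classical
    intro h x x' hx
    have := congrFun (congrFun (h (Pi.single (P.m x) 1)) x) x'
    rw [Matrix.mul_diagonal, Matrix.diagonal_mul] at this
    simpa [hx] using this

end Finite

variable [Fintype C] [∀ a b : C, Finite (a ⟶ b)]

theorem eProj_baseRep (q q' : Arr C → C) :
    eProj (baseRep q) (baseRep q') = ofRel fun x y => x = y ∧ q x.1 = q' x.2 := by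
  classical
  ext x y
  simp only [eProj, baseRep_kronecker_baseRep, Matrix.sum_apply, ofRel_apply,
    Matrix.diagonal_apply, Set.indicator_apply, Set.mem_singleton_iff]
  by_cases hxy : x = y
  · simp [hxy, eq_comm]
  · simp [hxy]

theorem isMPI : IsMPI P.I P.α P.β P.βhat where
  injective_alpha := baseRep_injective fun a => ⟨unit a, P.m_unit a⟩
  injective_beta := baseRep_injective fun a => ⟨unit a, rfl⟩
  injective_beta' := baseRep_injective fun a => ⟨unit a, rfl⟩
  commute_alpha_beta := baseRep_commute _ _
  commute_alpha_beta' := baseRep_commute _ _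
  commute_beta_beta' := baseRep_commute _ _
  trace_beta n := by
    simp only [α, β, baseRep_apply, Matrix.trace_diagonal]
    -- horizontal inversion carries the upper right corner to the upper left one
    refine Fintype.sum_equiv (Function.Involutive.toPerm _ P.squares.H.inv_inv) _ _ fun g => ?_
    congr 1
    change P.m g = (P.squares.H.inv g).r
    rw [← unit_inj, ← Hr_Vr, ← Vr_Hs, ← P.squares.H.r_inv, P.squares.r_r]
  trace_beta' n := by
    simp only [α, βhat, baseRep_apply, Matrix.trace_diagonal]
    -- vertical inversion carries the upper right corner to the lower right one
    refine Fintype.sum_equiv (Function.Involutive.toPerm _ P.squares.V.inv_inv) _ _ fun g => ?_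
    congr 1
    change P.m g = (P.squares.V.inv g).s
    rw [← unit_inj, ← Vs_Hs, ← Hs_Vr, ← P.squares.V.s_inv, P.squares.s_s]
  initial := by
    rw [I_eq_mpi, P.squares.conjTranspose_mul_mpi, βhat, α, eProj_baseRep]
    exact ofRel_congr fun p q => by rw [Vs_Hs, Hs_Vr, unit_inj]
  final := by
    rw [I_eq_mpi, P.squares.mpi_mul_conjTranspose, α, β, eProj_baseRep]
    exact ofRel_congr fun p q => by rw [Vr_Hs, Hr_Vr, unit_inj]
  commute n n' := by
    ext p q
    rw [β, βhat, baseRep_kronecker_baseRep, I_eq_mpi, Matrix.mul_diagonal, Matrix.diagonal_mul,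
      VacantDoubleGroupoid.mpi, ofRel_apply]
    split_ifs with h
    · obtain ⟨h1, h2, h3, h4⟩ := P.corners_of_IRel h
      rw [h1, h2, mul_comm]
    · simp
  intertwine n n' := by
    ext p q
    rw [α, β, βhat, baseRep_kronecker_baseRep, baseRep_kronecker_baseRep, I_eq_mpi,
      Matrix.mul_diagonal, Matrix.diagonal_mul, VacantDoubleGroupoid.mpi, ofRel_apply]
    split_ifs with h
    · obtain ⟨h1, h2, h3, h4⟩ := P.corners_of_IRel h
      rw [h3, h4]
      ring
    · simp
  pentagon := by
    rw [I_eq_mpi]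
    exact P.squares.pentagon

end MatchPair

/-! ### The crossed products -/

section Reindex

variable {ι κ γ : Type*} [Fintype ι] [DecidableEq ι] [Fintype κ] [DecidableEq κ]

/-- The isomorphism of the operators on `ℓ²(κ)` with those on `ℓ²(ι)` given by a bijection. -/
def reindexStar (σ : κ ≃ ι) : Matrix κ κ ℂ →⋆ₐ[ℂ] Matrix ι ι ℂ :=
  { (Matrix.reindexAlgEquiv ℂ ℂ σ).toAlgHom with map_star' := fun _ => rfl }

theorem reindexStar_apply (σ : κ ≃ ι) (M : Matrix κ κ ℂ) (i j : ι) :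
    reindexStar σ M i j = M (σ.symm i) (σ.symm j) := rfl

theorem reindexStar_injective (σ : κ ≃ ι) : Function.Injective (reindexStar σ) :=
  (Matrix.reindexAlgEquiv ℂ ℂ σ).injective

theorem exists_faithful_rep (T : StarSubalgebra ℂ (Matrix κ κ ℂ)) :
    ∃ (n : ℕ) (π : T →⋆ₐ[ℂ] Matrix (Fin n) (Fin n) ℂ), Function.Injective π :=
  ⟨_, (reindexStar (Fintype.equivFin κ)).comp T.subtype,
    (reindexStar_injective _).comp Subtype.val_injective⟩

/-- The `*`-algebra spanned by a family which is closed under products and adjoints. -/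
def spanStar (M : γ → Matrix ι ι ℂ) (one : 1 ∈ Submodule.span ℂ (Set.range M))
    (mul : ∀ x y, M x * M y ∈ Submodule.span ℂ (Set.range M))
    (star_mem : ∀ x, star (M x) ∈ Submodule.span ℂ (Set.range M)) :
    StarSubalgebra ℂ (Matrix ι ι ℂ) where
  toSubalgebra := (Submodule.span ℂ (Set.range M)).toSubalgebra one fun a b ha hb => by
    have h := Submodule.mul_mem_mul ha hb
    rw [Submodule.span_mul_span] at h
    refine Submodule.span_le.2 ?_ h
    rintro _ ⟨_, ⟨x, rfl⟩, _, ⟨y, rfl⟩, rfl⟩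
    exact mul x y
  star_mem' {a} ha := by
    change star a ∈ Submodule.span ℂ (Set.range M)
    change a ∈ Submodule.span ℂ (Set.range M) at ha
    induction ha using Submodule.span_induction with
    | mem x h => obtain ⟨g, rfl⟩ := h; exact star_mem g
    | zero => simp
    | add x y _ _ hx hy => rw [star_add]; exact add_mem hx hy
    | smul c x _ hx => rw [star_smul]; exact Submodule.smul_mem _ _ hx

/-- A `*`-algebra of operators on `ℓ²(κ)`, given by generators, is identified with the span of a
linearly independent family of operators on `ℓ²(ι)` as soon as the generators are carried into the
span of the family, and the members of the family come from the algebra. -/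
theorem exists_starAlgEquiv_adjoin (σ : κ ≃ ι) (X : Set (Matrix κ κ ℂ)) {M : γ → Matrix ι ι ℂ}
    (hM : LinearIndependent ℂ M) (one : 1 ∈ Submodule.span ℂ (Set.range M))
    (mul : ∀ x y, M x * M y ∈ Submodule.span ℂ (Set.range M))
    (star_mem : ∀ x, star (M x) ∈ Submodule.span ℂ (Set.range M))
    (hX : ∀ x ∈ X, reindexStar σ x ∈ Submodule.span ℂ (Set.range M))
    (hX' : ∀ g, ∃ x ∈ StarAlgebra.adjoin ℂ X, reindexStar σ x = M g) :
    ∃ (S : StarSubalgebra ℂ (Matrix ι ι ℂ)) (Φ : StarAlgebra.adjoin ℂ X ≃⋆ₐ[ℂ] S)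
      (e : Module.Basis γ ℂ (StarAlgebra.adjoin ℂ X)),
      (S : Set (Matrix ι ι ℂ)) = Submodule.span ℂ (Set.range M) ∧
      (∀ a p q, (Φ a : Matrix ι ι ℂ) (σ p) (σ q) = (a : Matrix κ κ ℂ) p q) ∧
      ∀ g, S.subtype.comp (Φ : StarAlgebra.adjoin ℂ X →⋆ₐ[ℂ] S) (e g) = M g := by
  let F : StarAlgebra.adjoin ℂ X →⋆ₐ[ℂ] Matrix ι ι ℂ :=
    (reindexStar σ).comp (StarAlgebra.adjoin ℂ X).subtype
  have hF : Function.Injective F := (reindexStar_injective σ).comp Subtype.val_injective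
  have hle : StarAlgebra.adjoin ℂ X ≤ (spanStar M one mul star_mem).comap (reindexStar σ) :=
    StarAlgebra.adjoin_le fun x hx => hX x hx
  have hrange : LinearMap.range F.toAlgHom.toLinearMap = Submodule.span ℂ (Set.range M) := by
    apply le_antisymm
    · rintro _ ⟨a, rfl⟩
      exact hle a.2
    · rw [Submodule.span_le]
      rintro _ ⟨g, rfl⟩
      obtain ⟨x, hx, h⟩ := hX' g
      exact ⟨⟨x, hx⟩, h⟩
  refine ⟨F.range, StarAlgEquiv.ofInjective F hF, (Module.Basis.span hM).map
    ((LinearEquiv.ofEq _ _ hrange.symm).trans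
      (LinearEquiv.ofInjective F.toAlgHom.toLinearMap hF).symm), ?_, ?_, ?_⟩
  · rw [← hrange]
    rfl
  · intro a p q
    change reindexStar σ a (σ p) (σ q) = _
    rw [reindexStar_apply, σ.symm_apply_apply, σ.symm_apply_apply]
  · intro g
    change F.toAlgHom.toLinearMap ((LinearEquiv.ofInjective F.toAlgHom.toLinearMap hF).symm _) = _
    rw [← LinearEquiv.ofInjective_apply (h := hF), LinearEquiv.apply_symm_apply]
    exact congrArg Subtype.val (Module.Basis.span_apply hM g)

end Reindex

namespace ArrowGroupoid

variable {G : Type*} (V : ArrowGroupoid G)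

theorem leftReg_mem (g : G) : V.leftReg g ∈ Submodule.span ℂ (Set.range V.leftReg) :=
  Submodule.subset_span ⟨g, rfl⟩

theorem rightReg_mem (g : G) : V.rightReg g ∈ Submodule.span ℂ (Set.range V.rightReg) :=
  Submodule.subset_span ⟨g, rfl⟩

variable [Fintype G] [DecidableEq G]

theorem exists_starAlgEquiv_leftReg {κ : Type*} [Fintype κ] [DecidableEq κ] (σ : κ ≃ G)
    (X : Set (Matrix κ κ ℂ))
    (hX : ∀ x ∈ X, reindexStar σ x ∈ Submodule.span ℂ (Set.range V.leftReg))
    (hX' : ∀ g, ∃ x ∈ StarAlgebra.adjoin ℂ X, reindexStar σ x = V.leftReg g) :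
    ∃ (S : StarSubalgebra ℂ (Matrix G G ℂ)) (Φ : StarAlgebra.adjoin ℂ X ≃⋆ₐ[ℂ] S)
      (e : Module.Basis G ℂ (StarAlgebra.adjoin ℂ X)),
      (S : Set (Matrix G G ℂ)) = Submodule.span ℂ (Set.range V.leftReg) ∧
      (∀ a p q, (Φ a : Matrix G G ℂ) (σ p) (σ q) = (a : Matrix κ κ ℂ) p q) ∧
      ∀ g, S.subtype.comp (Φ : StarAlgebra.adjoin ℂ X →⋆ₐ[ℂ] S) (e g) = V.leftReg g := by
  refine exists_starAlgEquiv_adjoin σ X V.leftReg_linearIndependent ?_ ?_ ?_ hX hX'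
  · rw [V.leftReg_units]
    refine sum_mem fun g _ => ?_
    split_ifs
    exacts [V.leftReg_mem g, zero_mem _]
  · intro x y
    rw [V.leftReg_mul]
    split_ifs
    exacts [V.leftReg_mem _, zero_mem _]
  · intro x
    rw [V.star_leftReg]
    exact V.leftReg_mem _

theorem exists_starAlgEquiv_rightReg {κ : Type*} [Fintype κ] [DecidableEq κ] (σ : κ ≃ G)
    (X : Set (Matrix κ κ ℂ))
    (hX : ∀ x ∈ X, reindexStar σ x ∈ Submodule.span ℂ (Set.range V.rightReg))
    (hX' : ∀ g, ∃ x ∈ StarAlgebra.adjoin ℂ X, reindexStar σ x = V.rightReg g) :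
    ∃ (S : StarSubalgebra ℂ (Matrix G G ℂ)) (Φ : StarAlgebra.adjoin ℂ X ≃⋆ₐ[ℂ] S)
      (e : Module.Basis G ℂ (StarAlgebra.adjoin ℂ X)),
      (S : Set (Matrix G G ℂ)) = Submodule.span ℂ (Set.range V.rightReg) ∧
      (∀ a p q, (Φ a : Matrix G G ℂ) (σ p) (σ q) = (a : Matrix κ κ ℂ) p q) ∧
      ∀ g, S.subtype.comp (Φ : StarAlgebra.adjoin ℂ X →⋆ₐ[ℂ] S) (e g) = V.rightReg g := by
  refine exists_starAlgEquiv_adjoin σ X V.rightReg_linearIndependent ?_ ?_ ?_ hX hX'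
  · rw [V.rightReg_units]
    refine sum_mem fun g _ => ?_
    split_ifs
    exacts [V.rightReg_mem g, zero_mem _]
  · intro x y
    rw [V.rightReg_mul]
    split_ifs
    exacts [V.rightReg_mem _, zero_mem _]
  · intro x
    rw [V.star_rightReg]
    exact V.rightReg_mem _

end ArrowGroupoid

namespace MatchPair

open Arr

variable {C : Type u} [Groupoid.{v} C] (P : MatchPair C)

theorem leftReg_apply (g y y' : Arr C) :
    P.squares.V.leftReg g y y' = ofRel (fun y y' => P.q₂ g = P.p₁ y' ∧ y = P.q₁ g * y') y y' :=
  rfl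

theorem rightReg_apply (g x x' : Arr C) :
    P.squares.H.rightReg g x x' = ofRel (fun x x' => P.p₂ x = P.q₁ g ∧ x' = P.p₁ x * g) x x' :=
  rfl

theorem p₁_mul_of_p₂_eq {x g : Arr C} (h : P.p₂ x = P.q₁ g) : P.p₁ x * g = x * P.q₂ g :=
  P.swap.q₁_mul_eq h

variable [Finite C] [∀ a b : C, Finite (a ⟶ b)]

/-- The identification `(h, k) ↦ k h` of the fibre product with the set of arrows. -/
noncomputable def leftEquiv : P.leftAction.Fib ≃ Arr C where
  toFun p := p.1.2.1 * p.1.1.1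
  invFun g := ⟨(⟨P.q₂ g, P.q₂_mem g⟩, ⟨P.q₁ g, P.q₁_mem g⟩), (P.s_q₁ g).symm⟩
  left_inv := by
    rintro ⟨⟨⟨h, hh⟩, ⟨k, hk⟩⟩, e⟩
    have e' : k.s = h.r := e.symm
    simp only [Subtype.mk.injEq, Prod.mk.injEq]
    grind
  right_inv g := P.q₁_mul_q₂ g

/-- The identification `(k, h) ↦ k h` of the fibre product with the set of arrows. -/
noncomputable def rightEquiv : P.rightAction.Fib ≃ Arr C where
  toFun p := p.1.1.1 * p.1.2.1
  invFun g := ⟨(⟨P.q₁ g, P.q₁_mem g⟩, ⟨P.q₂ g, P.q₂_mem g⟩), P.s_q₁ g⟩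
  left_inv := by
    rintro ⟨⟨⟨k, hk⟩, ⟨h, hh⟩⟩, e⟩
    have e' : k.s = h.r := e
    simp only [Subtype.mk.injEq, Prod.mk.injEq]
    grind
  right_inv g := P.q₁_mul_q₂ g

theorem reindex_gamma (a : SubArr P.H → ℂ) :
    reindexStar P.leftEquiv (P.leftAction.gamma a) =
      Matrix.diagonal fun g => a ⟨P.p₁ g, P.p₁_mem g⟩ := by
  ext x y
  rw [reindexStar_apply, LeftAction.gamma, Matrix.diagonal_apply, Matrix.diagonal_apply]
  simp only [EmbeddingLike.apply_eq_iff_eq]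
  congr 2
  exact Subtype.ext (congrArg P.p₁ (P.q₁_mul_q₂ x))

theorem reindex_lam (k : SubArr P.K) :
    reindexStar P.leftEquiv (P.leftAction.lam k) =
      ofRel fun y y' => k.1.s = y'.r ∧ y = k.1 * y' := by
  ext y y'
  simp only [reindexStar_apply, LeftAction.lam, Matrix.of_apply, ofRel_apply]
  congr 1
  rw [eq_iff_iff]
  change (P.q₁ y).r = k.1.r ∧ (⟨P.q₂ y', P.q₂_mem y'⟩ : SubArr P.H) = ⟨P.q₂ y, P.q₂_mem y⟩ ∧
    P.q₁ y' = k.1⁻¹ * P.q₁ y ↔ _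
  obtain ⟨k, hk⟩ := k
  simp only [Subtype.mk.injEq]
  constructor
  · rintro ⟨h1, h2, h3⟩
    have h4 : y' = k⁻¹ * y := by
      rw [← P.q₁_mul_q₂ y', h2, h3, Arr.assoc (by grind) (P.s_q₁ y), P.q₁_mul_q₂]
    grind
  · rintro ⟨h1, rfl⟩
    grind

theorem reindex_delta (a : SubArr P.K → ℂ) :
    reindexStar P.rightEquiv (P.rightAction.delta a) =
      Matrix.diagonal fun g => a ⟨P.p₂ g, P.p₂_mem g⟩ := by
  ext x y
  rw [reindexStar_apply, RightAction.delta, Matrix.diagonal_apply, Matrix.diagonal_apply]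
  simp only [EmbeddingLike.apply_eq_iff_eq]
  congr 2
  exact Subtype.ext (congrArg P.p₂ (P.q₁_mul_q₂ x))

theorem reindex_rho (h : SubArr P.H) :
    reindexStar P.rightEquiv (P.rightAction.rho h) =
      ofRel fun x x' => x.s = h.1.r ∧ x' = x * h.1 := by
  ext x x'
  simp only [reindexStar_apply, RightAction.rho, Matrix.of_apply, ofRel_apply]
  congr 1
  rw [eq_iff_iff]
  change (P.q₂ x).s = h.1.r ∧ (⟨P.q₁ x', P.q₁_mem x'⟩ : SubArr P.K) = ⟨P.q₁ x, P.q₁_mem x⟩ ∧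
    P.q₂ x' = P.q₂ x * h.1 ↔ _
  obtain ⟨h, hh⟩ := h
  simp only [Subtype.mk.injEq]
  constructor
  · rintro ⟨h1, h2, h3⟩
    have h4 : x' = x * h := by
      rw [← P.q₁_mul_q₂ x', h2, h3, ← Arr.assoc (P.s_q₁ x) h1, P.q₁_mul_q₂]
    grind
  · rintro ⟨h1, rfl⟩
    grind

/-- The multiplication by `a ∘ p₁` is the combination of the `L g` over the vertical units. -/
theorem diagonal_p₁_mem (a : SubArr P.H → ℂ) :
    (Matrix.diagonal fun g => a ⟨P.p₁ g, P.p₁_mem g⟩) ∈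
      Submodule.span ℂ (Set.range P.squares.V.leftReg) := by
  have : (Matrix.diagonal fun g => a ⟨P.p₁ g, P.p₁_mem g⟩) =
      ∑ h : SubArr P.H, a h • P.squares.V.leftReg h.1 := by
    ext y y'
    simp only [Matrix.sum_apply, Matrix.smul_apply, leftReg_apply, ofRel_apply, smul_eq_mul]
    rw [Finset.sum_eq_single ⟨P.p₁ y', P.p₁_mem y'⟩]
    · have h1 : P.q₂ (P.p₁ y') = P.p₁ y' := P.q₂_of_mem_H (P.p₁_mem y')
      have h2 : P.q₁ (P.p₁ y') * y' = y' := by grind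
      by_cases h : y = y' <;> simp [h, h1, h2]
    · rintro ⟨h, hh⟩ _ hne
      rw [if_neg, mul_zero]
      rintro ⟨h1, _⟩
      exact hne (Subtype.ext ((P.q₂_of_mem_H hh).symm.trans h1))
    · simp
  rw [this]
  exact sum_mem fun h _ => Submodule.smul_mem _ _ (P.squares.V.leftReg_mem _)

/-- The multiplication by `a ∘ p₂` is the combination of the `R g` over the horizontal units. -/
theorem diagonal_p₂_mem (a : SubArr P.K → ℂ) :
    (Matrix.diagonal fun g => a ⟨P.p₂ g, P.p₂_mem g⟩) ∈
      Submodule.span ℂ (Set.range P.squares.H.rightReg) := by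
  have : (Matrix.diagonal fun g => a ⟨P.p₂ g, P.p₂_mem g⟩) =
      ∑ k : SubArr P.K, a k • P.squares.H.rightReg k.1 := by
    ext x x'
    simp only [Matrix.sum_apply, Matrix.smul_apply, rightReg_apply, ofRel_apply, smul_eq_mul]
    rw [Finset.sum_eq_single ⟨P.p₂ x, P.p₂_mem x⟩]
    · have h1 : P.q₁ (P.p₂ x) = P.p₂ x := P.q₁_of_mem_K (P.p₂_mem x)
      by_cases h : x = x'
      · simp [← h, h1, P.p₁_mul_p₂]
      · simp [h, h1, P.p₁_mul_p₂, Ne.symm h]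
    · rintro ⟨k, hk⟩ _ hne
      rw [if_neg, mul_zero]
      rintro ⟨h1, _⟩
      exact hne (Subtype.ext (h1.trans (P.q₁_of_mem_K hk)).symm)
    · simp
  rw [this]
  exact sum_mem fun h _ => Submodule.smul_mem _ _ (P.squares.H.rightReg_mem _)

/-- The left translation by `k` is the sum of the `L g` over the squares `g` with left side `k`. -/
theorem lam_mem {k : Arr C} (hk : k.MemOf P.K) :
    (ofRel fun y y' : Arr C => k.s = y'.r ∧ y = k * y') ∈
      Submodule.span ℂ (Set.range P.squares.V.leftReg) := by
  have : (ofRel fun y y' : Arr C => k.s = y'.r ∧ y = k * y') =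
      ∑ g with P.q₁ g = k, P.squares.V.leftReg g := by
    change _ = ∑ g with P.q₁ g = k, ofRel fun y y' => P.q₂ g = P.p₁ y' ∧ y = P.q₁ g * y'
    rw [sum_ofRel]
    · refine ofRel_congr fun y y' => ⟨?_, ?_⟩
      · rintro ⟨h, rfl⟩
        have h' : k.s = (P.p₁ y').r := by rw [h, P.r_p₁]
        refine ⟨k * P.p₁ y', ?_, ?_, ?_⟩
        · simp only [Finset.mem_filter, Finset.mem_univ, true_and]
          grind
        · grind
        · grind
      · rintro ⟨g, hg, h1, rfl⟩
        simp only [Finset.mem_filter, Finset.mem_univ, true_and] at hg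
        refine ⟨?_, by rw [hg]⟩
        rw [← hg, P.s_q₁, h1, P.r_p₁]
    · rintro y y' g hg g' hg' ⟨h1, _⟩ ⟨h2, _⟩
      simp only [Finset.mem_filter, Finset.mem_univ, true_and] at hg hg'
      rw [← P.q₁_mul_q₂ g, ← P.q₁_mul_q₂ g', hg, hg', h1, h2]
  rw [this]
  exact sum_mem fun g _ => P.squares.V.leftReg_mem _

/-- The right translation by `h` is the sum of the `R g` over the squares `g` with lower side
`h`. -/
theorem rho_mem {h : Arr C} (hh : h.MemOf P.H) :
    (ofRel fun x x' : Arr C => x.s = h.r ∧ x' = x * h) ∈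
      Submodule.span ℂ (Set.range P.squares.H.rightReg) := by
  have : (ofRel fun x x' : Arr C => x.s = h.r ∧ x' = x * h) =
      ∑ g with P.q₂ g = h, P.squares.H.rightReg g := by
    change _ = ∑ g with P.q₂ g = h, ofRel fun x x' => P.p₂ x = P.q₁ g ∧ x' = P.p₁ x * g
    rw [sum_ofRel]
    · refine ofRel_congr fun x x' => ⟨?_, ?_⟩
      · rintro ⟨e, rfl⟩
        have e' : (P.p₂ x).s = h.r := by rw [P.s_p₂, e]
        have e1 : P.q₁ (P.p₂ x * h) = P.p₂ x := by grind
        have e2 : P.q₂ (P.p₂ x * h) = h := by grind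
        refine ⟨P.p₂ x * h, ?_, e1.symm, ?_⟩
        · simp only [Finset.mem_filter, Finset.mem_univ, true_and]
          exact e2
        · rw [P.p₁_mul_of_p₂_eq e1.symm, e2]
      · rintro ⟨g, hg, h1, rfl⟩
        simp only [Finset.mem_filter, Finset.mem_univ, true_and] at hg
        refine ⟨?_, by rw [P.p₁_mul_of_p₂_eq h1, hg]⟩
        rw [← hg, ← P.s_q₁, ← h1, P.s_p₂]
    · rintro x x' g hg g' hg' ⟨h1, _⟩ ⟨h2, _⟩
      simp only [Finset.mem_filter, Finset.mem_univ, true_and] at hg hg'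
      rw [← P.q₁_mul_q₂ g, ← P.q₁_mul_q₂ g', hg, hg', ← h1, ← h2]
  rw [this]
  exact sum_mem fun g _ => P.squares.H.rightReg_mem _

/-- The crossed product `C(K) ⋉ C(H)` is the left regular representation of the vertical
groupoid. -/
theorem exists_leftCrossed_equiv :
    ∃ (S : StarSubalgebra ℂ (Matrix (Arr C) (Arr C) ℂ)) (Φ : P.leftCrossed ≃⋆ₐ[ℂ] S)
      (e : Module.Basis (Arr C) ℂ P.leftCrossed),
      (S : Set (Matrix (Arr C) (Arr C) ℂ)) = legS P.squares.mpi ∧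
      (∀ a p q, (Φ a : Matrix (Arr C) (Arr C) ℂ)
        (p.1.2.1 * p.1.1.1) (q.1.2.1 * q.1.1.1) =
          (a : Matrix P.leftAction.Fib P.leftAction.Fib ℂ) p q) ∧
      ∀ g, S.subtype.comp (Φ : P.leftCrossed →⋆ₐ[ℂ] S) (e g) = P.squares.V.leftReg g := by
  rw [VacantDoubleGroupoid.legS_mpi]
  refine P.squares.V.exists_starAlgEquiv_leftReg P.leftEquiv _ ?_ ?_
  · rintro _ (⟨a, rfl⟩ | ⟨k, rfl⟩)
    · rw [reindex_gamma]
      exact P.diagonal_p₁_mem a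
    · rw [reindex_lam]
      exact P.lam_mem k.2
  · intro g
    -- `L g` is a translation by the left side of `g` cut down by the lower side of `g`
    refine ⟨P.leftAction.lam ⟨P.q₁ g, P.q₁_mem g⟩ *
      P.leftAction.gamma (Pi.single ⟨P.q₂ g, P.q₂_mem g⟩ 1),
      mul_mem (StarAlgebra.subset_adjoin _ _ (Or.inr ⟨_, rfl⟩))
        (StarAlgebra.subset_adjoin _ _ (Or.inl ⟨_, rfl⟩)), ?_⟩
    rw [map_mul, reindex_lam, reindex_gamma]
    ext y y'
    rw [Matrix.mul_diagonal, leftReg_apply, ofRel_apply, ofRel_apply, Pi.single_apply]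
    simp only [Subtype.mk.injEq]
    by_cases h1 : P.p₁ y' = P.q₂ g
    · have h2 : (P.q₁ g).s = y'.r := by rw [P.s_q₁, ← h1, P.r_p₁]
      simp [h1, h2]
    · simp [h1, Ne.symm h1]

/-- The crossed product `C(K) ⋊ C(H)` is the right regular representation of the horizontal
groupoid. -/
theorem exists_rightCrossed_equiv :
    ∃ (S : StarSubalgebra ℂ (Matrix (Arr C) (Arr C) ℂ)) (Ψ : P.rightCrossed ≃⋆ₐ[ℂ] S)
      (f : Module.Basis (Arr C) ℂ P.rightCrossed),
      (S : Set (Matrix (Arr C) (Arr C) ℂ)) = legShat P.squares.mpi ∧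
      (∀ a p q, (Ψ a : Matrix (Arr C) (Arr C) ℂ)
        (p.1.1.1 * p.1.2.1) (q.1.1.1 * q.1.2.1) =
          (a : Matrix P.rightAction.Fib P.rightAction.Fib ℂ) p q) ∧
      ∀ g, S.subtype.comp (Ψ : P.rightCrossed →⋆ₐ[ℂ] S) (f g) = P.squares.H.rightReg g := by
  rw [VacantDoubleGroupoid.legShat_mpi]
  refine P.squares.H.exists_starAlgEquiv_rightReg P.rightEquiv _ ?_ ?_
  · rintro _ (⟨a, rfl⟩ | ⟨k, rfl⟩)
    · rw [reindex_delta]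
      exact P.diagonal_p₂_mem a
    · rw [reindex_rho]
      exact P.rho_mem k.2
  · intro g
    -- `R g` is a translation by the lower side of `g` cut down by the left side of `g`
    refine ⟨P.rightAction.delta (Pi.single ⟨P.q₁ g, P.q₁_mem g⟩ 1) *
      P.rightAction.rho ⟨P.q₂ g, P.q₂_mem g⟩,
      mul_mem (StarAlgebra.subset_adjoin _ _ (Or.inl ⟨_, rfl⟩))
        (StarAlgebra.subset_adjoin _ _ (Or.inr ⟨_, rfl⟩)), ?_⟩
    rw [map_mul, reindex_rho, reindex_delta]
    ext x x'
    rw [Matrix.diagonal_mul, rightReg_apply, ofRel_apply, ofRel_apply, Pi.single_apply]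
    simp only [Subtype.mk.injEq]
    by_cases h1 : P.p₂ x = P.q₁ g
    · have h2 : x.s = (P.q₂ g).r := by rw [← P.s_p₂, h1, P.s_q₁]
      simp [h1, h2, P.p₁_mul_of_p₂_eq h1]
    · simp [h1]

end MatchPair

end MatchedPair

theorem mainTheorem4 {C : Type u} [Groupoid.{v} C] [Fintype C] [∀ a b : C, Finite (a ⟶ b)]
    (P : MatchPair C) :
    IsMPI P.I P.α P.β P.βhat ∧
    IsRegularMPI P.I P.α ∧
    ∃ S Shat : StarSubalgebra ℂ (Matrix (Arr C) (Arr C) ℂ),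
      (S : Set (Matrix (Arr C) (Arr C) ℂ)) = legS P.I ∧
      (Shat : Set (Matrix (Arr C) (Arr C) ℂ)) = legShat P.I ∧
      ∃ (Φ : P.leftCrossed ≃⋆ₐ[ℂ] S) (Ψ : P.rightCrossed ≃⋆ₐ[ℂ] Shat),
        (∀ a p q, (Φ a : Matrix (Arr C) (Arr C) ℂ)
          (p.1.2.1 * p.1.1.1) (q.1.2.1 * q.1.1.1) =
            (a : Matrix P.leftAction.Fib P.leftAction.Fib ℂ) p q) ∧
        (∀ a p q, (Ψ a : Matrix (Arr C) (Arr C) ℂ)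
          (p.1.1.1 * p.1.2.1) (q.1.1.1 * q.1.2.1) =
            (a : Matrix P.rightAction.Fib P.rightAction.Fib ℂ) p q) ∧
        ∃ (V : WeakHopfCStar P.leftCrossed) (W : WeakHopfCStar P.rightCrossed)
          (br : P.leftCrossed →ₗ[ℂ] P.rightCrossed →ₗ[ℂ] ℂ),
          IsInducedOnS P.I (S.subtype.comp (Φ : P.leftCrossed →⋆ₐ[ℂ] S)) V ∧
          IsInducedOnShat P.I (Shat.subtype.comp (Ψ : P.rightCrossed →⋆ₐ[ℂ] Shat)) W ∧
          IsInducedBracket P.I (S.subtype.comp (Φ : P.leftCrossed →⋆ₐ[ℂ] S))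
            (Shat.subtype.comp (Ψ : P.rightCrossed →⋆ₐ[ℂ] Shat)) br ∧
          IsDuality V W br := by
  refine ⟨P.isMPI, P.isRegularMPI, ?_⟩
  rw [P.I_eq_mpi]
  obtain ⟨S, Φ, e, hS, hΦ, hΦe⟩ := P.exists_leftCrossed_equiv
  obtain ⟨Shat, Ψ, f, hShat, hΨ, hΨf⟩ := P.exists_rightCrossed_equiv
  have he := (VacantDoubleGroupoid.isConvolutionBasis_leftReg hΦe).2
  have hf := (VacantDoubleGroupoid.isConvolutionBasis_rightReg hΨf).2
  exact ⟨S, Shat, hS, hShat, Φ, Ψ, hΦ, hΨ,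
    VacantDoubleGroupoid.weakHopf he (exists_faithful_rep _),
    VacantDoubleGroupoid.weakHopf hf (exists_faithful_rep _),
    VacantDoubleGroupoid.bracket e f,
    VacantDoubleGroupoid.isInducedOnS hΦe he _,
    VacantDoubleGroupoid.isInducedOnShat hΨf hf _,
    VacantDoubleGroupoid.isInducedBracket hΦe hΨf,
    VacantDoubleGroupoid.isDuality he hf _ _⟩
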